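/- **Setting.** Consider networks $w=G(q,\theta)w+Rr+\begin{bmatrix}\tilde H(q,\theta)\\0\end{bmatrix}\tilde e$, $w_{\mathcal C}=Cw$, with $L$ internal signals $\mathcal W=\{w_1,\dots,w_L\}$, measured excitation signals $r_1,\dots,r_K$ entering at distinct internal signals ($R$ consists of $K$ columns of the identity), a set $\mathcal C\subseteq\mathcal W$ of measured internal signals selected by $C$, and white noise $\tilde e$ with $|\mathcal C|$ components and covariance $\tilde\Lambda(\theta)$ acting on the measured signals only. Let $\mathcal M$ be such a model set, $\theta\in\Theta\subseteq\mathbb R^n$, such that for all $\theta\in\Theta$: $G$ is real rational, proper, stable and hollow; $T:=(I-G)^{-1}$ is stable; all principal minors of $\lim_{z\to\infty}(I-G(z))$ are nonzero; the square matrix $\tilde H$ is real rational, proper, stable, monic and minimum phase; $\tilde\Lambda\succeq0$ is real. Assume moreover that * for every $\theta\in\Theta$ the spectrum of $w_{\mathcal C}$ has full rank at almost all frequencies; * the entries of $G$ and $\tilde H$ are parameterized in rational form and independently: each is a quotient of polynomials in $z$ whose coefficients are real-analytic functions on $\mathbb R^n$ (the denominator being nonzero for all $\theta\in\Theta$), and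 different entries involve disjoint blocks of parameters; * either $G$ is strictly proper for all $\theta\in\Theta$, or $\tilde\Lambda(\theta)$ is diagonal for all $\theta\in\Theta$ and $G^\infty(\theta)=\lim_{z\to\infty}G(z,\theta)$ is lower triangular after one simultaneous row and column permutation independent of $\theta$; * every submatrix of $[\,G-I\;\;X\,]$, $X=\left[R\;\;\begin{smallmatrix}\tilde H\\0\end{smallmatrix}\right]$, that does not depend on $\theta$ has rank equal to its structural rank (the maximal rank of matrices with the same zero pattern). The graph of $\mathcal M$ has vertices $\mathcal W\cup\mathcal X$, $\mathcal X$ being the set of all $r$ and $\tilde e$ signals, and one edge for each entry of $(G,R,\tilde H)$ that is not fixed to zero; an edge is *known* if its entry does not depend on $\theta\in\Theta$, otherwise *unknown*. $b_{\mathcal S\to\mathcal S'}$ is the maximum number of vertex-disjoint directed paths from $\mathcal S$ to $\mathcal S'$ (a single vertex is a path), and $\mathcal D$ is an $\mathcal S-\mathcal S'$ *disconnecting set* if it meets every path from $\mathcal S$ to $\mathcal S'$. $\mathcal X_j$ is the set of external signals without an unknown edge to $w_j$; $\mathcal N_j^-$ the internal in-neighbors of $w_j$ except the measured ones with a known edge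 to $w_j$; $\mathcal N_i^*$ all internal in-neighbors of $w_i$; $\mathcal N_i^+$ the out-neighbors of $w_i$ except those to which $w_i$ has a known edge and which are excited by an external signal of out-degree one with a known edge. $T_{\mathcal A\mathcal B}$ denotes the submatrix of $T$ (if $\mathcal B\subseteq\mathcal W$) or of $TX$ (if $\mathcal B\subseteq\mathcal X$). "Generically" means for all $\theta\in\Theta$ outside a Lebesgue null set. $A^\dagger$ is any generalized inverse over $\mathbb R(z)$, i.e. $AA^\dagger A=A$ (in particular any left or right inverse, whenever there is one). **Proposition.** Suppose that all fixed modules (entries of $G$ not depending on $\theta$) are zero, and let $i\neq j$. 1. Let $w_i,w_j\in\mathcal C$, $\bar{\mathcal X}\subseteq\mathcal X_j$, $\bar{\mathcal C}\subseteq\mathcal C\setminus\{w_i\}$, and let $\mathcal D$ be an $\bar{\mathcal X}-(\mathcal N_j^-\setminus\{w_i\})\cup\bar{\mathcal C}$ disconnecting set with $b_{\bar{\mathcal X}\to\{w_i\}\cup\mathcal D}=|\mathcal D|+1$ and $b_{\mathcal D\to\bar{\mathcal C}}=|\mathcal D|$. If $w_j\notin\mathcal D$ and $\bar{\mathcal X}$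 has no directed edge to $w_j$, then generically $$G_{ji}=T_{j\bar{\mathcal X}}\begin{bmatrix}T_{i\bar{\mathcal X}}\\T_{\bar{\mathcal C}\bar{\mathcal X}}\end{bmatrix}^\dagger\begin{bmatrix}1\\\mathbf 0\end{bmatrix}.$$ 2. Let $x_i,x_j\in\mathcal X$ have out-degree one and known edges to $w_i$ and $w_j$, respectively, let $\bar{\mathcal X}\subseteq\mathcal X_j\setminus\{x_j\}$, $\bar{\mathcal C}\subseteq\mathcal C$, and let $\mathcal D$ be a $(\mathcal N_i^+\setminus\{w_j\})\cup\bar{\mathcal X}-\bar{\mathcal C}$ disconnecting set with $b_{\{w_j\}\cup\mathcal D\to\bar{\mathcal C}}=|\mathcal D|+1$ and $b_{\bar{\mathcal X}\to\mathcal D}=|\mathcal D|$. If $w_i\notin\mathcal D\cup\bar{\mathcal C}$, then generically $$G_{ji}=\begin{bmatrix}1&\mathbf 0\end{bmatrix}\begin{bmatrix}T_{\bar{\mathcal C}j}&T_{\bar{\mathcal C}\bar{\mathcal X}}\end{bmatrix}^\dagger T_{\bar{\mathcal C}i}.$$ 3. Let $w_j\in\mathcal C$, $w_i\notin\mathcal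 C$, let $x_i\in\mathcal X$ be an $r$-signal with out-degree one and a known edge to $w_i$, let $\bar{\mathcal X}\subseteq\mathcal X_j\setminus\{x_i\}$, $\bar{\mathcal C}\subseteq\mathcal C$, $\tilde{\mathcal X}=\bar{\mathcal X}\cup\{x_i\}$, and let $\mathcal D$ be an $\tilde{\mathcal X}-\mathcal N_i^*\cup(\mathcal N_j^-\setminus\{w_i\})\cup\bar{\mathcal C}$ disconnecting set with $b_{\tilde{\mathcal X}\to\mathcal D\cup\{w_i\}}=1+|\mathcal D|$ and $b_{\mathcal D\to\bar{\mathcal C}}=|\mathcal D|$. If $w_j\notin\mathcal D$ and $\bar{\mathcal X}$ has no directed edge to $w_j$, then generically $$G_{ji}=T_{j\tilde{\mathcal X}}\begin{bmatrix}\mathbf e_{x_i}\\T_{\bar{\mathcal C}\tilde{\mathcal X}}\end{bmatrix}^\dagger\begin{bmatrix}1\\\mathbf 0\end{bmatrix},$$ where $\mathbf e_{x_i}$ is the standard basis row vector indexed by $\tilde{\mathcal X}$ with its one at $x_i$. 4. Let $w_i\in\mathcal C$, $w_j\notin\mathcal C$, let $x_j\in\mathcal X$ have out-degree one and a known edge to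 $w_j$, let $\bar{\mathcal X}\subseteq\mathcal X_j\setminus\{x_j\}$, $w_i\in\bar{\mathcal C}\subseteq\mathcal C$, and let $\mathcal D$ be a $(\mathcal N_i^+\setminus\{w_j\})\cup\bar{\mathcal X}\cup\{w_i\}-\bar{\mathcal C}$ disconnecting set with $b_{\{w_j\}\cup\mathcal D\to\bar{\mathcal C}}=|\mathcal D|+1$ and $b_{\bar{\mathcal X}\to\mathcal D}=|\mathcal D|$. Then generically $$G_{ji}=-\begin{bmatrix}1&\mathbf 0\end{bmatrix}\begin{bmatrix}T_{\bar{\mathcal C}j}&T_{\bar{\mathcal C}\bar{\mathcal X}}\end{bmatrix}^\dagger C_{\bar{\mathcal C}i},$$ where $C_{\bar{\mathcal C}i}$ is the vector indexed by $\bar{\mathcal C}$ with entry one at $w_i$ and zeros elsewhere. In each case the generalized inverse exists, and the formula holds for every choice of it. If moreover all external signals involved ($\bar{\mathcal X}$ in case 1; $\bar{\mathcal X}$, $x_i$, $x_j$ in case 2; $\bar{\mathcal X}$, $x_i$ in case 3; $\bar{\mathcal X}$, $x_j$ in case 4) are $r$-signals, then $G_{ji}$ is generically a function of the mapping $CTR$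 from the measured excitation signals to the measured internal signals only. -/

import Mathlib

namespace DynNet

/-! ### Rational transfer functions in the shift variable `z` -/

/-- Proper: the limit as `z → ∞` is finite. -/
def IsProper (f : RatFunc ℝ) : Prop := f.num.degree ≤ f.denom.degree

/-- Strictly proper: the limit as `z → ∞` is zero. -/
def IsStrictlyProper (f : RatFunc ℝ) : Prop := f.num.degree < f.denom.degree

/-- Stable: all poles lie in the open unit disc. -/
def IsStable (f : RatFunc ℝ) : Prop :=
  ∀ z : ℂ, Polynomial.aeval z f.denom = 0 → ‖z‖ < 1

/-- The limit as `z → ∞` of a proper rational function (the denominator `RatFunc.denom` is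
monic and coprime to the numerator). -/
noncomputable def atInfinity (f : RatFunc ℝ) : ℝ := f.num.coeff f.denom.natDegree

/-- The value `f(e^{iω})`. -/
noncomputable def freqResponse (ω : ℝ) (f : RatFunc ℝ) : ℂ :=
  RatFunc.eval (algebraMap ℝ ℂ) (Complex.exp (Complex.I * ω)) f

/-! ### Matrices -/

/-- The maximum rank of all matrices with the same pattern of nonzero entries. -/
noncomputable def structuralRank {m n F : Type*} [Fintype m] [Fintype n] [Field F]
    (A : Matrix m n F) : ℕ :=
  sSup {r : ℕ | ∃ B : Matrix m n F, (∀ a b, B a b = 0 ↔ A a b = 0) ∧ B.rank = r}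

/-- `B` is a generalized inverse (pseudo-inverse) of `A`. Left inverses, right inverses, and the
Moore-Penrose inverse with respect to any involution are all of this kind. -/
def IsGeneralizedInverse {m n F : Type*} [Fintype m] [Fintype n] [Field F]
    (A : Matrix m n F) (B : Matrix n m F) : Prop :=
  A * B * A = A

theorem IsGeneralizedInverse.of_left {m n F : Type*} [Fintype m] [Fintype n] [DecidableEq n]
    [Field F] {A : Matrix m n F} {B : Matrix n m F} (h : B * A = 1) :
    IsGeneralizedInverse A B := by
  rw [IsGeneralizedInverse, Matrix.mul_assoc, h, Matrix.mul_one]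

theorem IsGeneralizedInverse.of_right {m n F : Type*} [Fintype m] [Fintype n] [DecidableEq m]
    [Field F] {A : Matrix m n F} {B : Matrix n m F} (h : A * B = 1) :
    IsGeneralizedInverse A B := by
  rw [IsGeneralizedInverse, h, Matrix.one_mul]

/-! ### Directed graphs -/

section Graph

variable {V : Type*}

/-- `p` is a directed path from `a` to `b`, given by its list of vertices, without repetition.
A single vertex is a path from itself to itself. -/
def IsPath (E : V → V → Prop) (a b : V) (p : List V) : Prop :=
  p.IsChain E ∧ p.Nodup ∧ p.head? = some a ∧ p.getLast? = some b

/-- There are `k` pairwise vertex-disjoint directed paths from `S` to `S'`. -/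
def HasDisjointPaths (E : V → V → Prop) (S S' : Set V) (k : ℕ) : Prop :=
  ∃ p : Fin k → List V,
    (∀ s, ∃ a ∈ S, ∃ b ∈ S', IsPath E a b (p s)) ∧
    ∀ s t, s ≠ t → (p s).Disjoint (p t)

/-- The maximum number of vertex-disjoint directed paths from `S` to `S'`. -/
noncomputable def maxDisjointPaths (E : V → V → Prop) (S S' : Set V) : ℕ :=
  sSup {k : ℕ | HasDisjointPaths E S S' k}

/-- `D` intersects all directed paths from `S` to `S'`. -/
def IsDisconnecting (E : V → V → Prop) (S S' D : Set V) : Prop :=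
  ∀ a ∈ S, ∀ b ∈ S', ∀ p : List V, IsPath E a b p → ∃ v ∈ p, v ∈ D

end Graph

/-! ### Network models and parameterized model sets -/

/-- The data of a parameterized network model set
`w = G(q,θ) w + R r + [H(q,θ); 0] e`, `w_C = C w`, `θ ∈ Θ ⊆ ℝⁿ`, with `L` internal signals,
`K` measured excitation signals `r`, and a white noise `e` with one component for each measured
internal signal; the noise covariance is `Λ(θ)`. The signal `r_p` enters at `w_{exc p}`, that is,
`R` consists of `K` distinct columns of the identity matrix. -/
structure NetworkModelSet (L K n : ℕ) where
  /-- The measured internal signals. -/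
  C : Finset (Fin L)
  /-- The internal signals at which the excitation signals enter. -/
  exc : Fin K ↪ Fin L
  /-- The parameter set. -/
  Θ : Set (Fin n → ℝ)
  /-- The network matrix. -/
  G : (Fin n → ℝ) → Matrix (Fin L) (Fin L) (RatFunc ℝ)
  /-- The noise filter. -/
  H : (Fin n → ℝ) → Matrix C C (RatFunc ℝ)
  /-- The noise covariance. -/
  Λ : (Fin n → ℝ) → Matrix C C ℝ

namespace NetworkModelSet

variable {L K n : ℕ} (M : NetworkModelSet L K n)

/-- The external signals: excitation signals `r` on the left, noise signals on the right. -/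
abbrev Ext : Type := Fin K ⊕ M.C

/-- The vertices of the graph: internal signals on the left, external signals on the right. -/
abbrev Vert : Type := Fin L ⊕ M.Ext

/-- `X = [R  [H; 0]]`. -/
noncomputable def X (θ : Fin n → ℝ) : Matrix (Fin L) M.Ext (RatFunc ℝ) :=
  Matrix.of fun k x => match x with
    | Sum.inl p => if M.exc p = k then 1 else 0
    | Sum.inr e => if h : k ∈ M.C then M.H θ ⟨k, h⟩ e else 0

/-- `T = (I - G)⁻¹`, the mapping between internal signals. -/
noncomputable def T (θ : Fin n → ℝ) : Matrix (Fin L) (Fin L) (RatFunc ℝ) := (1 - M.G θ)⁻¹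

/-- `T_{WX} = T X`, the mapping from external to internal signals. -/
noncomputable def TX (θ : Fin n → ℝ) : Matrix (Fin L) M.Ext (RatFunc ℝ) := M.T θ * M.X θ

/-- `C T R`, the mapping from measured excitation signals to measured internal signals. -/
noncomputable def CTR (θ : Fin n → ℝ) : Matrix M.C (Fin K) (RatFunc ℝ) :=
  (M.TX θ).submatrix Subtype.val Sum.inl

/-- The power spectrum `C Φ(ω) Cᵀ` of the measured internal signals. -/
noncomputable def measuredSpectrum (θ : Fin n → ℝ) (ω : ℝ) : Matrix M.C M.C ℂ :=
  let S : Matrix M.C M.C ℂ :=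
    ((M.TX θ).submatrix Subtype.val Sum.inr).map (freqResponse ω)
  S * (M.Λ θ).map (algebraMap ℝ ℂ) * S.conjTranspose

/-! #### Standing assumptions -/

/-- Every member of the set is an admissible network model: `G` is proper, stable and hollow;
`(I - G)⁻¹` is stable; the network is well-posed; `H` is proper, stable, monic and minimum phase;
`Λ` is positive semi-definite. -/
structure IsAdmissible : Prop where
  proper : ∀ θ ∈ M.Θ, ∀ k l, IsProper (M.G θ k l)
  stable : ∀ θ ∈ M.Θ, ∀ k l, IsStable (M.G θ k l)
  hollow : ∀ θ ∈ M.Θ, ∀ k, M.G θ k k = 0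
  stable_T : ∀ θ ∈ M.Θ, ∀ k l, IsStable (M.T θ k l)
  wellPosed : ∀ θ ∈ M.Θ, ∀ S : Finset (Fin L),
    ((1 - (M.G θ).map atInfinity).submatrix
      (Subtype.val : S → Fin L) (Subtype.val : S → Fin L)).det ≠ 0
  proper_H : ∀ θ ∈ M.Θ, ∀ k l, IsProper (M.H θ k l)
  stable_H : ∀ θ ∈ M.Θ, ∀ k l, IsStable (M.H θ k l)
  monic_H : ∀ θ ∈ M.Θ, (M.H θ).map atInfinity = 1
  minPhase_H : ∀ θ ∈ M.Θ, ∀ k l, IsStable ((M.H θ)⁻¹ k l)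
  psd : ∀ θ ∈ M.Θ, (M.Λ θ).PosSemidef

/-- The power spectrum of the measured internal signals has full rank at almost all
frequencies. -/
def FullRankSpectrum : Prop :=
  ∀ θ ∈ M.Θ, ∀ᵐ ω : ℝ, (M.measuredSpectrum θ ω).rank = M.C.card

/-- The positions of the entries of `G` and `H`. -/
abbrev Entry : Type := (Fin L × Fin L) ⊕ (M.C × M.C)

/-- The entry of `G` or `H` at a given position. -/
def entry (e : M.Entry) (θ : Fin n → ℝ) : RatFunc ℝ :=
  match e with
  | Sum.inl (k, l) => M.G θ k l
  | Sum.inr (k, l) => M.H θ k l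

/-- The entries of `G` and `H` are parameterized in rational form and independently: each entry
is a quotient of two polynomials in `z` whose coefficients are real-analytic functions of the
parameters, and different entries involve disjoint blocks of parameters. -/
def IndependentlyParameterized : Prop :=
  ∃ block : M.Entry → Set (Fin n),
    Pairwise (fun e e' => Disjoint (block e) (block e')) ∧
    ∀ e, ∃ a b : (Fin n → ℝ) → Polynomial ℝ,
      (∀ k, AnalyticOnNhd ℝ (fun θ => (a θ).coeff k) Set.univ) ∧
      (∀ k, AnalyticOnNhd ℝ (fun θ => (b θ).coeff k) Set.univ) ∧
      DependsOn a (block e) ∧ DependsOn b (block e) ∧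
      ∀ θ ∈ M.Θ, a θ ≠ 0 ∧
        M.entry e θ = algebraMap (Polynomial ℝ) (RatFunc ℝ) (b θ) /
          algebraMap (Polynomial ℝ) (RatFunc ℝ) (a θ)

/-- Either `G` is strictly proper, or `Λ` is diagonal and there are no algebraic loops, that is,
the direct feedthrough of `G` is lower triangular after a simultaneous permutation. -/
def FeedThrough : Prop :=
  (∀ θ ∈ M.Θ, ∀ k l, IsStrictlyProper (M.G θ k l)) ∨
  ((∀ θ ∈ M.Θ, (M.Λ θ).IsDiag) ∧
    ∃ σ : Equiv.Perm (Fin L), ∀ θ ∈ M.Θ, ∀ k l, k < l →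
      atInfinity (M.G θ (σ k) (σ l)) = 0)

/-- `f` does not depend on the parameters. -/
def IsFixed (f : (Fin n → ℝ) → RatFunc ℝ) : Prop :=
  ∀ θ ∈ M.Θ, ∀ θ' ∈ M.Θ, f θ = f θ'

/-- `f` is fixed to zero. -/
def IsFixedZero (f : (Fin n → ℝ) → RatFunc ℝ) : Prop := ∀ θ ∈ M.Θ, f θ = 0

/-- The matrix `[G - I  X]`. -/
noncomputable def GX (θ : Fin n → ℝ) : Matrix (Fin L) M.Vert (RatFunc ℝ) :=
  Matrix.fromCols (M.G θ - 1) (M.X θ)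

/-- Every submatrix of `[G - I  X]` that does not depend on the parameters has rank equal to its
structural rank. -/
def FixedEntriesRegular : Prop :=
  ∀ (I : Finset (Fin L)) (J : Finset M.Vert),
    (∀ k ∈ I, ∀ v ∈ J, M.IsFixed fun θ => M.GX θ k v) →
    ∀ θ ∈ M.Θ,
      ((M.GX θ).submatrix (Subtype.val : I → Fin L) (Subtype.val : J → M.Vert)).rank =
        structuralRank
          ((M.GX θ).submatrix (Subtype.val : I → Fin L) (Subtype.val : J → M.Vert))

/-- All fixed modules (entries of `G`) are zero. -/
def FixedModulesZero : Prop :=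
  ∀ k l, M.IsFixed (fun θ => M.G θ k l) → M.IsFixedZero fun θ => M.G θ k l

/-- `P` holds for almost all parameters in the parameter set. -/
def Generically (P : (Fin n → ℝ) → Prop) : Prop :=
  ∀ᵐ θ : Fin n → ℝ, θ ∈ M.Θ → P θ

/-! #### The graph of a model set -/

/-- The entry of `(G, R, H)` that describes the direct influence of vertex `v` on `w_k`. -/
noncomputable def gain (v : M.Vert) (k : Fin L) (θ : Fin n → ℝ) : RatFunc ℝ :=
  match v with
  | Sum.inl l => M.G θ k l
  | Sum.inr x => M.X θ k x

/-- Directed edges: entries that are not fixed to zero. -/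
def Edge (v u : M.Vert) : Prop := ∃ k, u = Sum.inl k ∧ ¬ M.IsFixedZero (M.gain v k)

/-- The edge from `v` to `w_k` is present and known. -/
def KnownEdge (v : M.Vert) (k : Fin L) : Prop :=
  M.Edge v (Sum.inl k) ∧ M.IsFixed (M.gain v k)

/-- The edge from `v` to `w_k` is present and unknown. -/
def UnknownEdge (v : M.Vert) (k : Fin L) : Prop :=
  M.Edge v (Sum.inl k) ∧ ¬ M.IsFixed (M.gain v k)

/-- The external signal `x` has out-degree one and a known edge to `w_k`. -/
def Excites (x : M.Ext) (k : Fin L) : Prop :=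
  M.KnownEdge (Sum.inr x) k ∧ ∀ u, M.Edge (Sum.inr x) u → u = Sum.inl k

/-- `X_j`: the external signals without an unknown edge to `w_j`. -/
def XNoUnknown (j : Fin L) : Set M.Ext := {x | ¬ M.UnknownEdge (Sum.inr x) j}

/-- `N_i^*`: the in-neighbors of `w_i` among the internal signals. -/
def inNbrs (i : Fin L) : Set (Fin L) := {k | M.Edge (Sum.inl k) (Sum.inl i)}

/-- `N_j^-`: the internal in-neighbors of `w_j`, without the measured signals that have a known
edge to `w_j`. -/
def NMinus (j : Fin L) : Set (Fin L) :=
  {k | M.Edge (Sum.inl k) (Sum.inl j) ∧ ¬ (k ∈ M.C ∧ M.KnownEdge (Sum.inl k) j)}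

/-- `N_i^+`: the out-neighbors of `w_i`, without those to which `w_i` has a known edge and which
are excited by an external signal of out-degree one with a known out-going edge. -/
def NPlus (i : Fin L) : Set (Fin L) :=
  {k | M.Edge (Sum.inl i) (Sum.inl k) ∧
    ¬ (M.KnownEdge (Sum.inl i) k ∧ ∃ x : M.Ext, M.Excites x k)}

/-- The maximum number of vertex-disjoint paths in the graph of the model set. -/
noncomputable def b (S S' : Set M.Vert) : ℕ := maxDisjointPaths M.Edge S S'

/-- A set of internal signals as a set of vertices. -/
def intV (S : Set (Fin L)) : Set M.Vert := Sum.inl '' S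

/-- A set of external signals as a set of vertices. -/
def extV (S : Set M.Ext) : Set M.Vert := Sum.inr '' S

/-! #### The four graphical identifiability conditions -/

/-- Input and output measured. -/
structure CondMeasured (i j : Fin L) (Xb : Finset M.Ext) (Cb : Finset (Fin L))
    (D : Finset M.Vert) : Prop where
  Xb_sub : (Xb : Set M.Ext) ⊆ M.XNoUnknown j
  Cb_sub : Cb ⊆ M.C \ {i}
  disconnecting : IsDisconnecting M.Edge (M.extV Xb) (M.intV ((M.NMinus j \ {i}) ∪ Cb)) D
  excitation : M.b (M.extV Xb) (M.intV {i} ∪ D) = D.card + 1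
  measurement : M.b D (M.intV Cb) = D.card
  input_measured : i ∈ M.C
  output_measured : j ∈ M.C

/-- Input and output excited. -/
structure CondExcited (i j : Fin L) (xi xj : M.Ext) (Xb : Finset M.Ext) (Cb : Finset (Fin L))
    (D : Finset M.Vert) : Prop where
  input_excited : M.Excites xi i
  output_excited : M.Excites xj j
  Xb_sub : (Xb : Set M.Ext) ⊆ M.XNoUnknown j \ {xj}
  Cb_sub : Cb ⊆ M.C
  disconnecting : IsDisconnecting M.Edge (M.intV (M.NPlus i \ {j}) ∪ M.extV Xb) (M.intV Cb) D
  measurement : M.b (M.intV {j} ∪ D) (M.intV Cb) = D.card + 1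
  excitation : M.b (M.extV Xb) D = D.card

/-- Input unmeasured but excited, output measured. -/
structure CondUnmeasuredInput (i j : Fin L) (xi : M.Ext) (Xb : Finset M.Ext)
    (Cb : Finset (Fin L)) (D : Finset M.Vert) : Prop where
  output_measured : j ∈ M.C
  input_unmeasured : i ∉ M.C
  input_excited : M.Excites xi i
  Xb_sub : (Xb : Set M.Ext) ⊆ M.XNoUnknown j \ {xi}
  Cb_sub : Cb ⊆ M.C
  disconnecting : IsDisconnecting M.Edge (M.extV (Xb ∪ {xi}))
    (M.intV (M.inNbrs i ∪ (M.NMinus j \ {i}) ∪ Cb)) D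
  excitation : M.b (M.extV (Xb ∪ {xi})) (D ∪ M.intV {i}) = 1 + D.card
  measurement : M.b D (M.intV Cb) = D.card

/-- Input measured, output unmeasured but excited. -/
structure CondUnmeasuredOutput (i j : Fin L) (xj : M.Ext) (Xb : Finset M.Ext)
    (Cb : Finset (Fin L)) (D : Finset M.Vert) : Prop where
  input_measured : i ∈ M.C
  output_unmeasured : j ∉ M.C
  output_excited : M.Excites xj j
  Xb_sub : (Xb : Set M.Ext) ⊆ M.XNoUnknown j \ {xj}
  Cb_sub : Cb ⊆ M.C
  input_mem : i ∈ Cb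
  disconnecting : IsDisconnecting M.Edge
    (M.intV ((M.NPlus i \ {j}) ∪ {i}) ∪ M.extV Xb) (M.intV Cb) D
  measurement : M.b (M.intV {j} ∪ D) (M.intV Cb) = D.card + 1
  excitation : M.b (M.extV Xb) D = D.card

/-! #### Matrices in the identification formulas -/

/-- `[T_{i Xb}; T_{Cb Xb}]`. -/
noncomputable def stackInput (θ : Fin n → ℝ) (i : Fin L) (Xb : Finset M.Ext)
    (Cb : Finset (Fin L)) : Matrix (Unit ⊕ Cb) Xb (RatFunc ℝ) :=
  Matrix.fromRows ((M.TX θ).submatrix (fun _ => i) Subtype.val)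
    ((M.TX θ).submatrix Subtype.val Subtype.val)

/-- `[e_x; T_{Cb Xt}]`, where `e_x` is the standard basis row vector indexed by `Xt` with its one
at `x`. -/
noncomputable def stackExcitation (θ : Fin n → ℝ) (x : M.Ext) (Xt : Finset M.Ext)
    (Cb : Finset (Fin L)) : Matrix (Unit ⊕ Cb) Xt (RatFunc ℝ) :=
  Matrix.fromRows (Matrix.of fun _ y => if (y : M.Ext) = x then 1 else 0)
    ((M.TX θ).submatrix Subtype.val Subtype.val)

/-- `[T_{Cb j}  T_{Cb Xb}]`. -/
noncomputable def stackOutput (θ : Fin n → ℝ) (j : Fin L) (Xb : Finset M.Ext)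
    (Cb : Finset (Fin L)) : Matrix Cb (Unit ⊕ Xb) (RatFunc ℝ) :=
  Matrix.fromCols ((M.T θ).submatrix Subtype.val (fun _ => j))
    ((M.TX θ).submatrix Subtype.val Subtype.val)

/-- All the external signals in `S` are measured excitation signals `r`. -/
def OnlyR (S : Finset M.Ext) : Prop := ∀ x ∈ S, ∃ p : Fin K, x = Sum.inl p

/-- Generically, the module `G_{ji}` is a function of the mapping `C T R` from the measured
excitation signals to the measured internal signals. -/
def DeterminedByCTR (j i : Fin L) : Prop :=
  ∃ F : Matrix M.C (Fin K) (RatFunc ℝ) → RatFunc ℝ,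
    M.Generically fun θ => M.G θ j i = F (M.CTR θ)

end NetworkModelSet

/-- The vector `[1, 0, …, 0]`, with its one at the distinguished first index. -/
noncomputable def firstUnit {ι : Type*} : Unit ⊕ ι → RatFunc ℝ := Sum.elim (fun _ => 1) (fun _ => 0)

end DynNet

/-! The argument is linear algebra over `ℝ(z)`: generically the matrix `[G - I X]` annihilates every
response `(TXy, y)`, so each identification formula comes from a solvable linear system all of whose
solutions agree in the required quantity.

Cases 1 and 3. Take excitations `y` on the chosen external signals with zero response at `Cb` and
with `w_i = 1`. The disjoint paths from `D` to `Cb` force the response to vanish at `D` and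
everywhere beyond it, hence at all in-neighbors of `w_j` other than `w_i`; no excitation in use
enters at `w_j`, so the equation of `w_j` reads `w_j = G_{ji}`. Such `y` exist because the `|D| + 1`
paths to `{w_i} ∪ D` allow prescribing `1` at `w_i` and `0` on `D`. In case 3 the in-neighbors of
`w_i` vanish too, so the unmeasured `w_i` equals its excitation.

Cases 2 and 4 are dual. Injecting the column `G_{·i}` and subtracting `α` at `w_j` affects `Cb` only
through `D` and `w_j`. The part passing through `D` can be cancelled by `Xb`; the remaining
injection `G_{ji} - α` at `w_j` can be cancelled only if it is zero, because of the `|D| + 1` paths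
from `{w_j} ∪ D` to `Cb`.

Any generalized inverse returns a solution of a solvable system, which gives the formulas
(`InputFormula`, `OutputFormula`). If only `r`-signals are involved, two parameters with equal `CTR`
share their solutions, hence `G_{ji}`.

The generic statements about paths all rest on `generically_eq_zero_of_paths`. It pairs each row
with its predecessor on a path, or with itself off the paths, which gives a square submatrix of `[G
- I X]` with diagonal not fixed to zero. Its determinant is generically nonzero: by
`FixedRegular.exists_det_ne_zero` independently chosen entries can make it nonzero, disjoint
parameter blocks realize this choice at one point, and a real-analytic function that is nonzero
somewhere is nonzero almost everywhere. -/

/-! ### Zero sets of real-analytic functions -/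

open MeasureTheory in
/-- A real-analytic function on `ℝⁿ` that does not vanish identically is almost everywhere
nonzero. -/
theorem AnalyticOnNhd.ae_ne_zero_of_ne_zero {n : ℕ} {f : (Fin n → ℝ) → ℝ}
    (hf : AnalyticOnNhd ℝ f Set.univ) {x₀ : Fin n → ℝ} (hx₀ : f x₀ ≠ 0) :
    ∀ᵐ x, f x ≠ 0 := by
  induction n with
  | zero =>
    refine Filter.Eventually.of_forall fun x => ?_
    rwa [Subsingleton.elim x x₀]
  | succ n ih =>
    let e := MeasurableEquiv.piFinSuccAbove (fun _ : Fin (n + 1) => ℝ) 0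
    have he : MeasurePreserving e := volume_preserving_piFinSuccAbove (fun _ => ℝ) 0
    let g : (Fin n → ℝ) × ℝ → (Fin (n + 1) → ℝ) := fun p => Fin.cons p.2 p.1
    have hg : AnalyticOnNhd ℝ g Set.univ := by
      rw [analyticOnNhd_pi_iff]
      intro i
      refine Fin.cases ?_ (fun i => ?_) i
      · exact fun p _ => analyticAt_snd
      · exact fun p _ => ((ContinuousLinearMap.proj (R := ℝ) (φ := fun _ : Fin n => ℝ) i).comp
          (ContinuousLinearMap.fst ℝ (Fin n → ℝ) ℝ)).analyticAt p
    have hfg : AnalyticOnNhd ℝ (fun p => f (g p)) Set.univ := fun p _ =>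
      (hf (g p) trivial).comp (hg p trivial)
    have hcont : Continuous fun p => f (g p) := by
      rw [← continuousOn_univ]; exact hfg.continuousOn
    have hmeas : MeasurableSet {p : (Fin n → ℝ) × ℝ | ¬ f (g p) ≠ 0} := by
      simp only [ne_eq, not_not]
      exact (isClosed_eq hcont continuous_const).measurableSet
    have hprod : ∀ᵐ p : (Fin n → ℝ) × ℝ, f (g p) ≠ 0 := by
      -- Fubini: for almost every `y` the slice through `x₀ 0` is nonzero by induction, so `t ↦ f
      -- (y, t)` is a nonzero analytic function of one variable and its zeros are discrete.
      rw [Measure.volume_eq_prod, ae_iff, Measure.measure_prod_null hmeas]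
      have hslice : AnalyticOnNhd ℝ (fun y => f (g (y, x₀ 0))) Set.univ := fun y _ =>
        (hfg (y, x₀ 0) trivial).comp (f := fun y => (y, x₀ 0))
          (analyticAt_id.prod analyticAt_const)
      have hne : f (g (Fin.tail x₀, x₀ 0)) ≠ 0 := by
        simpa [g, Fin.cons_self_tail] using hx₀
      filter_upwards [ih hslice hne] with y hy
      have hline : AnalyticOnNhd ℝ (fun t => f (g (y, t))) Set.univ := fun t _ =>
        (hfg (y, t) trivial).comp (f := fun t => (y, t)) (analyticAt_const.prod analyticAt_id)
      have hcod := hline.preimage_zero_mem_codiscrete hy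
      have hae : ∀ᵐ t : ℝ, f (g (y, t)) ≠ 0 := by
        have h := ae_restrict_le_codiscreteWithin (μ := volume) (U := (Set.univ : Set ℝ))
          MeasurableSet.univ hcod
        rw [Measure.restrict_univ] at h
        filter_upwards [h] with t ht using ht
      exact ae_iff.mp hae
    have hswap : ∀ᵐ p : ℝ × (Fin n → ℝ), f (g p.swap) ≠ 0 := by
      have := (Measure.measurePreserving_swap (μ := (volume : Measure ℝ))
        (ν := (volume : Measure (Fin n → ℝ)))).quasiMeasurePreserving.ae
          (p := fun p => f (g p) ≠ 0) hprod
      exact this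
    have := he.quasiMeasurePreserving.ae hswap
    filter_upwards [this] with x hx
    have : g (e x).swap = x := by
      ext i
      refine Fin.cases ?_ (fun i => ?_) i
      · simp [g, e, MeasurableEquiv.piFinSuccAbove]
      · simp [g, e, MeasurableEquiv.piFinSuccAbove, Fin.insertNthEquiv, Fin.tail]
    rwa [this] at hx

/-! ### Generalized inverses over a field -/

namespace DynNet

/-- Over a field every matrix has a generalized inverse. -/
theorem exists_isGeneralizedInverse {m n F : Type*} [Fintype m] [Fintype n] [Field F]
    (A : Matrix m n F) : ∃ B, IsGeneralizedInverse A B := by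
  classical
  obtain ⟨g, hg⟩ := A.toLin'.rangeRestrict.exists_rightInverse_of_surjective
    (LinearMap.range_rangeRestrict _)
  -- `g` is a section of `A` over its range; any linear extension to the whole space is a
  -- generalized inverse.
  obtain ⟨h, hh⟩ := g.exists_extend
  refine ⟨LinearMap.toMatrix' h, ?_⟩
  apply Matrix.toLin'.injective
  rw [Matrix.toLin'_mul, Matrix.toLin'_mul, Matrix.toLin'_toMatrix']
  refine LinearMap.ext fun x => ?_
  have h1 : h (A.toLin' x) = g (A.toLin'.rangeRestrict x) := by
    rw [← hh]; rfl
  have h2 := congrArg Subtype.val (LinearMap.congr_fun hg (A.toLin'.rangeRestrict x))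
  simp only [LinearMap.comp_apply, h1]
  exact h2

/-- If `v` is in the range of `A`, then a generalized inverse of `A` yields a preimage of `v`. -/
theorem IsGeneralizedInverse.mulVec_mulVec {m n F : Type*} [Fintype m] [Fintype n] [Field F]
    {A : Matrix m n F} {B : Matrix n m F} (h : IsGeneralizedInverse A B) (x : n → F) :
    A.mulVec (B.mulVec (A.mulVec x)) = A.mulVec x := by
  rw [Matrix.mulVec_mulVec, Matrix.mulVec_mulVec, h]

/-! ### Regular matrices with independently chosen entries -/

section Choice

variable {m n F : Type} [Field F]

/-- Every square matrix with nonzero diagonal whose entries are all fixed is regular. -/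
def FixedRegular (V : m → n → Set F) : Prop :=
  ∀ (κ : Type) [Fintype κ] [DecidableEq κ] (f : κ → m) (g : κ → n), f.Injective → g.Injective →
    (∀ s t, (V (f s) (g t)).Subsingleton) → (∀ s, ∃ x ∈ V (f s) (g s), x ≠ 0) →
    ∀ A : Matrix m n F, (∀ a b, A a b ∈ V a b) → (A.submatrix f g).det ≠ 0

/-- Replacing row `k` by a unit row makes the matrix block triangular, with a `1 × 1` block equal to
`1`. -/
theorem det_updateRow_single_self {κ : Type} [Fintype κ] [DecidableEq κ] (A : Matrix κ κ F)
    (k : κ) : (A.updateRow k (Pi.single k 1)).det =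
      (A.submatrix (Subtype.val : {s // s ≠ k} → κ) (Subtype.val : {s // s ≠ k} → κ)).det := by
  rw [Matrix.twoBlockTriangular_det _ (fun s => s ≠ k)]
  · have h1 : Matrix.toSquareBlockProp (A.updateRow k (Pi.single k 1)) (fun s => ¬ s ≠ k) = 1 := by
      ext ⟨s, hs⟩ ⟨t, ht⟩
      obtain rfl := not_not.mp hs
      obtain rfl := not_not.mp ht
      simp [Matrix.toSquareBlockProp]
    rw [h1, Matrix.det_one, mul_one]
    congr 1
    ext ⟨s, hs⟩ ⟨t, ht⟩
    simp [Matrix.toSquareBlockProp, hs]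
  · intro s hs t ht
    obtain rfl := not_not.mp hs
    simp [ht]

/-- The value of an entry can be changed so that the determinant does not vanish, if the
complementary minor does not. -/
theorem exists_choice_of_minor {V : m → n → Set F} {κ : Type} [Fintype κ] [DecidableEq κ]
    {f : κ → m} {g : κ → n} (hf : f.Injective) (hg : g.Injective) (k : κ)
    (hk : (V (f k) (g k)).Nontrivial) {A : Matrix m n F} (hA : ∀ a b, A a b ∈ V a b)
    (hdet : (A.submatrix (f ∘ (Subtype.val : {s // s ≠ k} → κ))
      (g ∘ (Subtype.val : {s // s ≠ k} → κ))).det ≠ 0) :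
    ∃ A' : Matrix m n F, (∀ a b, A' a b ∈ V a b) ∧ (A'.submatrix f g).det ≠ 0 := by
  classical
  obtain ⟨x, hx, y, hy, hxy⟩ := hk
  let U (z : F) : Matrix m n F := Matrix.of fun a b => if a = f k ∧ b = g k then z else A a b
  have hU : ∀ z ∈ V (f k) (g k), ∀ a b, U z a b ∈ V a b := by
    intro z hz a b
    by_cases h : a = f k ∧ b = g k
    · simp only [U, Matrix.of_apply, if_pos h]; rwa [h.1, h.2]
    · simp only [U, Matrix.of_apply, if_neg h]; exact hA a b
  have hsub : ∀ z, (U z).submatrix f g = (A.submatrix f g).updateRow k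
      ((fun t => if t = k then 0 else A (f k) (g t)) + z • Pi.single k 1) := by
    intro z
    ext s t
    by_cases hs : s = k
    · subst hs
      by_cases ht : t = s
      · subst ht; simp [U]
      · simp [U, hg.eq_iff, ht]
    · simp [U, hf.eq_iff, hs]
  -- The determinant is affine in the entry, with the complementary minor as slope, so it cannot
  -- vanish at two distinct values.
  have hd : ∀ z, ((U z).submatrix f g).det =
      ((A.submatrix f g).updateRow k (fun t => if t = k then 0 else A (f k) (g t))).det +
        z * (A.submatrix (f ∘ (Subtype.val : {s // s ≠ k} → κ))
          (g ∘ (Subtype.val : {s // s ≠ k} → κ))).det := by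
    intro z
    rw [hsub, Matrix.det_updateRow_add, Matrix.det_updateRow_smul, det_updateRow_single_self]
    rfl
  by_cases h : ((U x).submatrix f g).det = 0
  · refine ⟨U y, hU y hy, fun h' => ?_⟩
    rw [hd] at h h'
    have : (x - y) * (A.submatrix (f ∘ (Subtype.val : {s // s ≠ k} → κ))
          (g ∘ (Subtype.val : {s // s ≠ k} → κ))).det = 0 := by linear_combination h - h'
    exact (mul_ne_zero (sub_ne_zero.mpr hxy) hdet) this
  · exact ⟨U x, hU x hx, h⟩

/-- If every entry of a matrix can be chosen independently from a given set, the fixed square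
submatrices with nonzero diagonal are regular and the diagonal of `V.submatrix f g` can be chosen
to be nonzero, then the entries can be chosen so that this submatrix is regular. -/
theorem FixedRegular.exists_det_ne_zero {V : m → n → Set F} (hV : FixedRegular V)
    (hne : ∀ a b, (V a b).Nonempty) (κ : Type) [Fintype κ] [DecidableEq κ] (f : κ → m) (g : κ → n)
    (hf : f.Injective) (hg : g.Injective) (hdiag : ∀ s, ∃ x ∈ V (f s) (g s), x ≠ 0) :
    ∃ A : Matrix m n F, (∀ a b, A a b ∈ V a b) ∧ (A.submatrix f g).det ≠ 0 := by
  classical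
  induction hN : Fintype.card κ using Nat.strong_induction_on generalizing κ with
  | _ N ih =>
  subst hN
  -- A free entry on the diagonal: induction makes the complementary minor nonzero, then this entry
  -- is adjusted. The column map `g` is generalized so that permuted columns are covered as well.
  have hcase : ∀ g : κ → n, g.Injective → (∀ s, ∃ x ∈ V (f s) (g s), x ≠ 0) →
      ∀ k, (V (f k) (g k)).Nontrivial →
      ∃ A : Matrix m n F, (∀ a b, A a b ∈ V a b) ∧ (A.submatrix f g).det ≠ 0 := by
    intro g hg hdiag k hk
    obtain ⟨A, hA, hdet⟩ := ih (Fintype.card {s // s ≠ k})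
      (Fintype.card_subtype_lt (x := k) (by simp)) {s // s ≠ k} (f ∘ Subtype.val)
      (g ∘ Subtype.val) (hf.comp Subtype.val_injective) (hg.comp Subtype.val_injective)
      (fun s => hdiag s) rfl
    refine exists_choice_of_minor hf hg k hk hA ?_
    convert hdet
  by_cases hfix : ∀ s t, (V (f s) (g t)).Subsingleton
  · choose A hA using hne
    exact ⟨A, hA, hV κ f g hf hg hfix hdiag A hA⟩
  push Not at hfix
  obtain ⟨k, l, hkl⟩ := hfix
  by_cases hlk : l = k
  · subst hlk
    exact hcase g hg hdiag l hkl
  let r : {s // s ≠ k} → Finset κ := fun s =>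
    Finset.univ.filter fun t => t ≠ l ∧ ∃ x ∈ V (f s) (g t), x ≠ 0
  -- Is there a nonzero transversal through the free entry `(k, l)`? If so, permuting columns brings
  -- that entry to the diagonal. If not, Hall's theorem yields a block triangular form.
  by_cases hall : ∃ τ : {s // s ≠ k} → κ, τ.Injective ∧ ∀ s, τ s ∈ r s
  · obtain ⟨τ, hτ, hτr⟩ := hall
    let σ : κ → κ := fun s => if h : s = k then l else τ ⟨s, h⟩
    have hτl : ∀ s, τ s ≠ l := fun s => (Finset.mem_filter.mp (hτr s)).2.1
    have hσk : σ k = l := by simp [σ]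
    have hσ' : ∀ s (h : s ≠ k), σ s = τ ⟨s, h⟩ := fun s h => by simp [σ, h]
    have hσ : σ.Injective := by
      intro s t hst
      by_cases hs : s = k <;> by_cases ht : t = k
      · rw [hs, ht]
      · rw [hs, hσk, hσ' t ht] at hst
        exact absurd hst.symm (hτl _)
      · rw [ht, hσk, hσ' s hs] at hst
        exact absurd hst (hτl _)
      · rw [hσ' s hs, hσ' t ht] at hst
        exact congrArg Subtype.val (hτ hst)
    obtain ⟨A, hA, hdet⟩ := hcase (g ∘ σ) (hg.comp hσ) (fun s => by
      by_cases hs : s = k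
      · subst hs
        rw [Function.comp_apply, hσk]
        obtain ⟨x, hx, y, hy, hxy⟩ := hkl
        by_cases h0 : x = 0
        · exact ⟨y, hy, fun h => hxy (h0.trans h.symm)⟩
        · exact ⟨x, hx, h0⟩
      · rw [Function.comp_apply, hσ' s hs]
        exact (Finset.mem_filter.mp (hτr ⟨s, hs⟩)).2.2) k (by
          rw [Function.comp_apply, hσk]; exact hkl)
    refine ⟨A, hA, fun h0 => hdet ?_⟩
    have := Matrix.det_permute' (Equiv.ofBijective σ (Finite.injective_iff_bijective.mp hσ))
      (A.submatrix f g)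
    rw [h0, mul_zero] at this
    exact this
  · rw [← Finset.all_card_le_biUnion_card_iff_exists_injective] at hall
    push Not at hall
    obtain ⟨S, hS⟩ := hall
    let P : Finset κ := S.map (Function.Embedding.subtype _)
    have hPk : k ∉ P := by simp [P]
    have hPsub : P.erase l ⊆ S.biUnion r := by
      intro s hs
      rw [Finset.mem_erase] at hs
      obtain ⟨hsl, hsP⟩ := hs
      obtain ⟨s', hs', rfl⟩ := Finset.mem_map.mp hsP
      exact Finset.mem_biUnion.mpr ⟨s', hs', Finset.mem_filter.mpr
        ⟨Finset.mem_univ _, hsl, hdiag _⟩⟩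
    have hPc : P.card = S.card := Finset.card_map _
    have hlP : l ∈ P := by
      by_contra h
      rw [Finset.erase_eq_of_notMem h] at hPsub
      have := Finset.card_le_card hPsub
      omega
    -- Hall's inequality fails for `S`, while the diagonal already supplies the columns `P \ {l}`.
    -- Hence `l ∈ P` and there are no other columns: the rows `P` vanish outside the columns `P`.
    have heq : P.erase l = S.biUnion r := by
      refine Finset.eq_of_subset_of_card_le hPsub ?_
      rw [Finset.card_erase_of_mem hlP]
      omega
    have hzero : ∀ s ∈ P, ∀ t ∉ P, ∀ x ∈ V (f s) (g t), x = 0 := by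
      intro s hs t ht x hx
      by_contra hx0
      obtain ⟨s', hs', rfl⟩ := Finset.mem_map.mp hs
      have htl : t ≠ l := fun h => ht (h ▸ hlP)
      have : t ∈ P.erase l := by
        rw [heq]
        exact Finset.mem_biUnion.mpr ⟨s', hs', Finset.mem_filter.mpr
          ⟨Finset.mem_univ _, htl, x, hx, hx0⟩⟩
      exact ht (Finset.mem_of_mem_erase this)
    -- Both diagonal blocks are smaller, since `k ∉ P` and `l ∈ P`; they occupy different rows, so
    -- their choices can be combined.
    obtain ⟨A₁, hA₁, hd₁⟩ := ih (Fintype.card {s // s ∈ P})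
      (Fintype.card_subtype_lt (x := k) hPk) {s // s ∈ P} (f ∘ Subtype.val)
      (g ∘ Subtype.val) (hf.comp Subtype.val_injective) (hg.comp Subtype.val_injective)
      (fun s => hdiag s) rfl
    obtain ⟨A₂, hA₂, hd₂⟩ := ih (Fintype.card {s // ¬ s ∈ P})
      (Fintype.card_subtype_lt (x := l) (by simpa using hlP)) {s // ¬ s ∈ P} (f ∘ Subtype.val)
      (g ∘ Subtype.val) (hf.comp Subtype.val_injective) (hg.comp Subtype.val_injective)
      (fun s => hdiag s) rfl
    refine ⟨Matrix.of fun a b => if ∃ s ∈ P, f s = a then A₁ a b else A₂ a b, fun a b => ?_, ?_⟩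
    · rw [Matrix.of_apply]
      split_ifs
      exacts [hA₁ a b, hA₂ a b]
    rw [Matrix.twoBlockTriangular_det' _ (fun s => s ∈ P)]
    · refine mul_ne_zero ?_ ?_
      · convert hd₁ using 2
        ext ⟨s, hs⟩ ⟨t, ht⟩
        simp [Matrix.toSquareBlockProp, hf.eq_iff, hs]
      · convert hd₂ using 2
        ext ⟨s, hs⟩ ⟨t, ht⟩
        simp [Matrix.toSquareBlockProp, hf.eq_iff, hs]
    · intro s hs t ht
      refine hzero s hs t ht _ ?_
      simpa [hf.eq_iff, hs] using hA₁ (f s) (g t)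

end Choice

/-! ### Structural rank and families of polynomials with analytic coefficients -/

/-- The choice theorem is applied to the zero pattern of `A`. Over an infinite field every nonzero
position is free, so fixed submatrices with nonzero diagonal are empty and `FixedRegular` is
trivial. -/
theorem card_le_structuralRank {m n κ F : Type} [Field F] [Infinite F] [Fintype m]
    [Fintype n] [Fintype κ] (A : Matrix m n F) (f : κ ≃ m) (g : κ ≃ n)
    (hA : ∀ s, A (f s) (g s) ≠ 0) : Fintype.card κ ≤ structuralRank A := by
  classical
  let V : m → n → Set F := fun a b => {x | x = 0 ↔ A a b = 0}
  have hV : FixedRegular V := by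
    intro ι _ _ f' g' _ _ hfix hdiag B hB
    have hι : IsEmpty ι := ⟨fun s => by
      obtain ⟨x, hx, hx0⟩ := hdiag s
      have h0 : A (f' s) (g' s) ≠ 0 := fun h => hx0 (hx.mpr h)
      obtain ⟨y, hy⟩ := Set.Infinite.nonempty ((Set.toFinite {0, x}).infinite_compl)
      simp only [Set.mem_compl_iff, Set.mem_insert_iff, Set.mem_singleton_iff, not_or] at hy
      exact hy.2 (hfix s s (show y = 0 ↔ _ from iff_of_false hy.1 h0) hx)⟩
    rw [Matrix.det_isEmpty]
    exact one_ne_zero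
  obtain ⟨B, hB, hdet⟩ := hV.exists_det_ne_zero (fun a b => ⟨A a b, Iff.rfl⟩) κ f g f.injective
    g.injective (fun s => ⟨A (f s) (g s), Iff.rfl, hA s⟩)
  refine le_csSup ⟨Fintype.card m, ?_⟩ ⟨B, fun a b => hB a b, ?_⟩
  · rintro _ ⟨C, -, rfl⟩
    exact C.rank_le_card_height
  · rw [← Matrix.rank_submatrix B f g]
    exact Matrix.rank_of_isUnit _ ((Matrix.isUnit_iff_isUnit_det _).mpr (isUnit_iff_ne_zero.mpr hdet))

theorem det_ne_zero_of_card_le_rank {κ F : Type} [Field F] [Fintype κ] [DecidableEq κ]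
    (A : Matrix κ κ F) (hA : Fintype.card κ ≤ A.rank) : A.det ≠ 0 := by
  rw [← isUnit_iff_ne_zero, ← Matrix.isUnit_iff_isUnit_det, ← Matrix.mulVec_surjective_iff_isUnit]
  have h : A.mulVecLin.range = ⊤ := by
    apply Submodule.eq_top_of_finrank_eq
    rw [Module.finrank_fintype_fun_eq_card]
    exact le_antisymm A.rank_le_card_height hA
  exact LinearMap.range_eq_top.mp h

/-- Families of polynomials whose coefficients are real-analytic functions of the parameters. -/
def analyticCoeffs (n : ℕ) : Subring ((Fin n → ℝ) → Polynomial ℝ) where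
  carrier := {p | ∀ k, AnalyticOnNhd ℝ (fun θ => (p θ).coeff k) Set.univ}
  mul_mem' := by
    intro p q hp hq k
    simp only [Pi.mul_apply, Polynomial.coeff_mul]
    exact Finset.analyticOnNhd_fun_sum _ fun x _ => (hp x.1).mul (hq x.2)
  one_mem' := fun _ => analyticOnNhd_const
  add_mem' := by
    intro p q hp hq k
    simp only [Pi.add_apply, Polynomial.coeff_add]
    exact (hp k).add (hq k)
  zero_mem' := fun _ => analyticOnNhd_const
  neg_mem' := by
    intro p hp k
    simp only [Pi.neg_apply, Polynomial.coeff_neg]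
    exact (hp k).neg

theorem ae_ne_zero_of_mem_analyticCoeffs {n : ℕ} {p : (Fin n → ℝ) → Polynomial ℝ}
    (hp : p ∈ analyticCoeffs n) {θ₀ : Fin n → ℝ} (h₀ : p θ₀ ≠ 0) : ∀ᵐ θ, p θ ≠ 0 := by
  obtain ⟨k, hk⟩ : ∃ k, (p θ₀).coeff k ≠ 0 := by
    by_contra! h
    exact h₀ (Polynomial.ext fun k => by simpa using h k)
  filter_upwards [(hp k).ae_ne_zero_of_ne_zero hk] with θ hθ h
  exact hθ (by rw [h, Polynomial.coeff_zero])

theorem det_mem_analyticCoeffs {n : ℕ} {κ : Type} [Fintype κ] [DecidableEq κ]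
    {P : κ → κ → (Fin n → ℝ) → Polynomial ℝ} (hP : ∀ s t, P s t ∈ analyticCoeffs n) :
    (fun θ => (Matrix.of fun s t => P s t θ).det) ∈ analyticCoeffs n := by
  have : (fun θ => (Matrix.of fun s t => P s t θ).det) =
      ∑ σ : Equiv.Perm κ, Equiv.Perm.sign σ • ∏ s, P (σ s) s := by
    ext1 θ
    simp [Matrix.det_apply, Finset.sum_apply, Finset.prod_apply]
  rw [this]
  refine Subring.sum_mem _ fun σ _ => ?_
  have hprod := Subring.prod_mem (analyticCoeffs n) (t := Finset.univ)
    (f := fun s => P (σ s) s) fun s _ => hP _ _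
  rcases Int.units_eq_one_or (Equiv.Perm.sign σ) with h | h <;> rw [h]
  · rwa [one_smul]
  · rw [Units.neg_smul, one_smul]
    exact Subring.neg_mem _ hprod

/-! ### Generic regularity of square submatrices of `[G - I X]` -/

namespace NetworkModelSet

variable {L K n : ℕ} {M : NetworkModelSet L K n}

theorem Generically.mono {P Q : (Fin n → ℝ) → Prop} (h : M.Generically P)
    (hPQ : ∀ θ ∈ M.Θ, P θ → Q θ) : M.Generically Q := by
  filter_upwards [h] with θ hθ hΘ using hPQ θ hΘ (hθ hΘ)

theorem Generically.and {P Q : (Fin n → ℝ) → Prop} (hP : M.Generically P)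
    (hQ : M.Generically Q) : M.Generically fun θ => P θ ∧ Q θ := by
  filter_upwards [hP, hQ] with θ h₁ h₂ hΘ using ⟨h₁ hΘ, h₂ hΘ⟩

/-- The values of an entry of `[G - I  X]`. -/
def GXValues (M : NetworkModelSet L K n) (k : Fin L) (v : M.Vert) : Set (RatFunc ℝ) :=
  (fun θ => M.GX θ k v) '' M.Θ

/-- A fixed submatrix with nonzero diagonal has full structural rank, which by assumption is its
rank; any admissible choice of its entries coincides with it. -/
theorem FixedEntriesRegular.fixedRegular (hreg : M.FixedEntriesRegular) :
    FixedRegular M.GXValues := by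
  classical
  intro κ _ _ f g hf hg hfix hdiag A hA
  cases isEmpty_or_nonempty κ with
  | inl h =>
    rw [Matrix.det_isEmpty]
    exact one_ne_zero
  | inr h =>
  obtain ⟨s₀⟩ := h
  obtain ⟨_, ⟨θ, hθ, -⟩, -⟩ := hdiag s₀
  have hAθ : A.submatrix f g = (M.GX θ).submatrix f g := by
    ext1 s t
    exact hfix s t (hA _ _) ⟨θ, hθ, rfl⟩
  let I : Finset (Fin L) := Finset.univ.map ⟨f, hf⟩
  let J : Finset M.Vert := Finset.univ.map ⟨g, hg⟩
  have hI : ∀ s, f s ∈ I := fun s => Finset.mem_map_of_mem ⟨f, hf⟩ (Finset.mem_univ s)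
  have hJ : ∀ s, g s ∈ J := fun s => Finset.mem_map_of_mem ⟨g, hg⟩ (Finset.mem_univ s)
  let ef : κ ≃ I := Equiv.ofBijective (fun s => ⟨f s, hI s⟩)
    ⟨fun s t h => hf (congrArg Subtype.val h), fun ⟨k, hk⟩ => by
      obtain ⟨s, -, rfl⟩ := Finset.mem_map.mp hk
      exact ⟨s, rfl⟩⟩
  let eg : κ ≃ J := Equiv.ofBijective (fun s => ⟨g s, hJ s⟩)
    ⟨fun s t h => hg (congrArg Subtype.val h), fun ⟨k, hk⟩ => by
      obtain ⟨s, -, rfl⟩ := Finset.mem_map.mp hk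
      exact ⟨s, rfl⟩⟩
  have hrank := hreg I J (fun k hk v hv θ₁ h₁ θ₂ h₂ => by
    obtain ⟨s, -, rfl⟩ := Finset.mem_map.mp hk
    obtain ⟨t, -, rfl⟩ := Finset.mem_map.mp hv
    exact hfix s t ⟨θ₁, h₁, rfl⟩ ⟨θ₂, h₂, rfl⟩) θ hθ
  have hle := card_le_structuralRank ((M.GX θ).submatrix (Subtype.val : I → Fin L)
    (Subtype.val : J → M.Vert)) ef eg (fun s => by
      obtain ⟨x, hx, hx0⟩ := hdiag s
      rwa [hfix s s hx ⟨θ, hθ, rfl⟩] at hx0)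
  rw [← hrank, ← Matrix.rank_submatrix _ ef eg] at hle
  rw [hAθ]
  exact det_ne_zero_of_card_le_rank _ hle

/-- The entries of `[G - I  X]` are quotients of polynomials with analytic coefficients, and their
numerators and denominators can be evaluated at independently chosen parameters. -/
theorem IndependentlyParameterized.exists_quotient (hpar : M.IndependentlyParameterized) :
    ∃ num den : Fin L → M.Vert → (Fin n → ℝ) → Polynomial ℝ,
      (∀ k v, num k v ∈ analyticCoeffs n) ∧ (∀ k v, den k v ∈ analyticCoeffs n) ∧
      (∀ θ ∈ M.Θ, ∀ k v, den k v θ ≠ 0 ∧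
        M.GX θ k v = algebraMap (Polynomial ℝ) (RatFunc ℝ) (num k v θ) /
          algebraMap (Polynomial ℝ) (RatFunc ℝ) (den k v θ)) ∧
      ∀ τ : Fin L → M.Vert → (Fin n → ℝ), ∃ θ₀, ∀ k v,
        num k v θ₀ = num k v (τ k v) ∧ den k v θ₀ = den k v (τ k v) := by
  classical
  obtain ⟨block, hblock, hentry⟩ := hpar
  -- Entries of `R`, and the zero rows below `H`, are constant; they receive the empty parameter
  -- block.
  let pos : Fin L → M.Vert → Option M.Entry := fun k v => match v with
    | Sum.inl l => some (Sum.inl (k, l))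
    | Sum.inr (Sum.inl _) => none
    | Sum.inr (Sum.inr e) => if h : k ∈ M.C then some (Sum.inr (⟨k, h⟩, e)) else none
  let blk : Fin L → M.Vert → Set (Fin n) := fun k v => (pos k v).elim ∅ block
  have hpos : ∀ k v k' v' e, pos k v = some e → pos k' v' = some e → k = k' ∧ v = v' := by
    clear hentry
    rintro k (l | p | x) k' (l' | p' | x') e h h' <;> simp only [pos, reduceCtorEq] at h h' <;>
      (try split_ifs at h) <;> (try split_ifs at h') <;>
      cases h <;> cases h' <;> exact ⟨rfl, rfl⟩
  have hblk : ∀ k v k' v' c, c ∈ blk k v → c ∈ blk k' v' → k = k' ∧ v = v' := by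
    intro k v k' v' c hc hc'
    rcases h : pos k v with _ | e
    · simp [blk, h] at hc
    rcases h' : pos k' v' with _ | e'
    · simp [blk, h'] at hc'
    have hce : c ∈ block e := by simpa [blk, h] using hc
    have hce' : c ∈ block e' := by simpa [blk, h'] using hc'
    have : e = e' := by
      by_contra hne
      exact Set.disjoint_left.mp (hblock hne) hce hce'
    subst this
    exact hpos _ _ _ _ _ h h'
  have key : ∀ k v, ∃ p q : (Fin n → ℝ) → Polynomial ℝ, p ∈ analyticCoeffs n ∧
      q ∈ analyticCoeffs n ∧ DependsOn p (blk k v) ∧ DependsOn q (blk k v) ∧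
      ∀ θ ∈ M.Θ, q θ ≠ 0 ∧
        M.GX θ k v = algebraMap (Polynomial ℝ) (RatFunc ℝ) (p θ) /
          algebraMap (Polynomial ℝ) (RatFunc ℝ) (q θ) := by
    have hconst : ∀ k v (c : Polynomial ℝ),
        (∀ θ, M.GX θ k v = algebraMap (Polynomial ℝ) (RatFunc ℝ) c) →
        ∃ p q : (Fin n → ℝ) → Polynomial ℝ, p ∈ analyticCoeffs n ∧
          q ∈ analyticCoeffs n ∧ DependsOn p (blk k v) ∧ DependsOn q (blk k v) ∧
          ∀ θ ∈ M.Θ, q θ ≠ 0 ∧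
            M.GX θ k v = algebraMap (Polynomial ℝ) (RatFunc ℝ) (p θ) /
              algebraMap (Polynomial ℝ) (RatFunc ℝ) (q θ) := by
      intro k v c hc
      refine ⟨fun _ => c, fun _ => 1, fun _ => analyticOnNhd_const, fun _ => analyticOnNhd_const,
        fun _ _ _ => rfl, fun _ _ _ => rfl, fun θ _ => ⟨one_ne_zero, ?_⟩⟩
      rw [hc, map_one, div_one]
    intro k v
    rcases v with l | p | x
    · obtain ⟨a, b, ha, hb, hda, hdb, h⟩ := hentry (Sum.inl (k, l))
      by_cases hkl : k = l
      -- On the diagonal the entry is `b / a - 1`.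
      · refine ⟨b - a, a, Subring.sub_mem _ hb ha, ha, fun θ θ' h => ?_, hda, fun θ hθ => ?_⟩
        · rw [Pi.sub_apply, Pi.sub_apply, hda h, hdb h]
        · obtain ⟨h0, h1⟩ := h θ hθ
          refine ⟨h0, ?_⟩
          have h0' : algebraMap (Polynomial ℝ) (RatFunc ℝ) (a θ) ≠ 0 := by simpa using h0
          have : M.GX θ k (Sum.inl l) = M.entry (Sum.inl (k, l)) θ - 1 := by
            simp [GX, entry, hkl]
          rw [this, h1, Pi.sub_apply, map_sub, sub_div, div_self h0']
      · refine ⟨b, a, hb, ha, hdb, hda, fun θ hθ => ⟨(h θ hθ).1, ?_⟩⟩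
        rw [← (h θ hθ).2]
        simp [GX, entry, hkl]
    · refine hconst k (Sum.inr (Sum.inl p)) (if M.exc p = k then 1 else 0) fun θ => ?_
      simp only [GX, X, Matrix.fromCols_apply_inr, Matrix.of_apply]
      split_ifs <;> simp
    · by_cases hk : k ∈ M.C
      · obtain ⟨a, b, ha, hb, hda, hdb, h⟩ := hentry (Sum.inr (⟨k, hk⟩, x))
        have hblk' : blk k (Sum.inr (Sum.inr x)) = block (Sum.inr (⟨k, hk⟩, x)) := by
          simp [blk, pos, hk]
        refine ⟨b, a, hb, ha, hblk' ▸ hdb, hblk' ▸ hda, fun θ hθ => ⟨(h θ hθ).1, ?_⟩⟩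
        rw [← (h θ hθ).2]
        simp [GX, X, entry, hk]
      · refine hconst k (Sum.inr (Sum.inr x)) 0 fun θ => ?_
        simp [GX, X, hk]
  choose num den hnum hden hdn hdd hq using key
  refine ⟨num, den, hnum, hden, fun θ hθ k v => hq k v θ hθ, fun τ => ?_⟩
  -- Each coordinate is taken from the parameter of the only entry whose block contains it;
  -- coordinates in no block are irrelevant.
  refine ⟨fun c => if h : ∃ kv : Fin L × M.Vert, c ∈ blk kv.1 kv.2
    then τ h.choose.1 h.choose.2 c else 0, fun k v => ?_⟩
  have : ∀ c ∈ blk k v, (if h : ∃ kv : Fin L × M.Vert, c ∈ blk kv.1 kv.2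
      then τ h.choose.1 h.choose.2 c else 0) = τ k v c := by
    intro c hc
    have h : ∃ kv : Fin L × M.Vert, c ∈ blk kv.1 kv.2 := ⟨(k, v), hc⟩
    rw [dif_pos h]
    obtain ⟨h1, h2⟩ := hblk _ _ _ _ c h.choose_spec hc
    rw [h1, h2]
  exact ⟨hdn k v this, hdd k v this⟩

/-- A square submatrix of `[G - I  X]` whose diagonal entries are not fixed to zero is generically
regular. -/
theorem generically_det_GX_ne_zero (hpar : M.IndependentlyParameterized)
    (hreg : M.FixedEntriesRegular) {κ : Type} [Fintype κ] [DecidableEq κ] {f : κ → Fin L}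
    {g : κ → M.Vert} (hf : f.Injective) (hg : g.Injective)
    (hdiag : ∀ s, ¬ M.IsFixedZero fun θ => M.GX θ (f s) (g s)) :
    M.Generically fun θ => ((M.GX θ).submatrix f g).det ≠ 0 := by
  rcases M.Θ.eq_empty_or_nonempty with hΘ | ⟨θ₁, hθ₁⟩
  · exact Filter.Eventually.of_forall fun θ hθ => by simp [hΘ] at hθ
  obtain ⟨num, den, hnum, hden, hq, hind⟩ := hpar.exists_quotient
  obtain ⟨A, hA, hdet⟩ := hreg.fixedRegular.exists_det_ne_zero
    (fun k v => ⟨_, θ₁, hθ₁, rfl⟩) κ f g hf hg (fun s => by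
      have := hdiag s
      simp only [IsFixedZero, not_forall] at this
      obtain ⟨θ, hθ, h⟩ := this
      exact ⟨_, ⟨θ, hθ, rfl⟩, h⟩)
  choose τ hτ hτA using hA
  -- `θ₀` need not lie in `Θ`. Its denominators are nonzero nevertheless, since each agrees with its
  -- value at some `τ k v ∈ Θ`.
  obtain ⟨θ₀, hθ₀⟩ := hind τ
  -- Each row is multiplied by the product of its denominators.
  let P : κ → κ → (Fin n → ℝ) → Polynomial ℝ := fun s t =>
    (∏ t' ∈ Finset.univ.erase t, den (f s) (g t')) * num (f s) (g t)
  have hP : ∀ s t, P s t ∈ analyticCoeffs n := fun s t =>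
    Subring.mul_mem _ (Subring.prod_mem _ fun _ _ => hden _ _) (hnum _ _)
  have hclear : ∀ (θ : Fin n → ℝ) (B : Matrix (Fin L) M.Vert (RatFunc ℝ)),
      (∀ k v, den k v θ ≠ 0 ∧ B k v = algebraMap (Polynomial ℝ) (RatFunc ℝ) (num k v θ) /
          algebraMap (Polynomial ℝ) (RatFunc ℝ) (den k v θ)) →
      ((B.submatrix f g).det ≠ 0 ↔ (Matrix.of fun s t => P s t θ).det ≠ 0) := by
    intro θ B hB
    have hne : ∀ k v, algebraMap (Polynomial ℝ) (RatFunc ℝ) (den k v θ) ≠ 0 := fun k v => by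
      simpa using (hB k v).1
    have h1 : (algebraMap (Polynomial ℝ) (RatFunc ℝ)).mapMatrix (Matrix.of fun s t => P s t θ) =
        Matrix.of fun s t =>
          (∏ t', algebraMap (Polynomial ℝ) (RatFunc ℝ) (den (f s) (g t') θ)) *
            (B.submatrix f g) s t := by
      ext1 s t
      simp only [P, RingHom.mapMatrix_apply, Matrix.map_apply, Matrix.of_apply, Pi.mul_apply,
        Finset.prod_apply, map_mul, map_prod, Matrix.submatrix_apply, (hB _ _).2]
      rw [← Finset.prod_erase_mul _ _ (Finset.mem_univ t)]
      have := hne (f s) (g t)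
      field_simp
    have h2 := (RingHom.map_det (algebraMap (Polynomial ℝ) (RatFunc ℝ))
      (Matrix.of fun s t => P s t θ)).symm
    rw [h1, Matrix.det_mul_column] at h2
    have h3 : (∏ s, ∏ t', algebraMap (Polynomial ℝ) (RatFunc ℝ) (den (f s) (g t') θ)) ≠ 0 :=
      Finset.prod_ne_zero_iff.mpr fun s _ => Finset.prod_ne_zero_iff.mpr fun t _ => hne _ _
    rw [← not_iff_not, not_not, not_not]
    constructor
    · intro h
      rw [h, mul_zero] at h2
      exact (map_eq_zero_iff _ (RatFunc.algebraMap_injective ℝ)).mp h2.symm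
    · intro h
      rw [h, map_zero] at h2
      exact (mul_eq_zero.mp h2).resolve_left h3
  have h₀ : (Matrix.of fun s t => P s t θ₀).det ≠ 0 := by
    refine (hclear θ₀ A fun k v => ?_).mp hdet
    rw [(hθ₀ k v).1, (hθ₀ k v).2, ← hτA k v]
    exact hq _ (hτ k v) k v
  filter_upwards [ae_ne_zero_of_mem_analyticCoeffs (det_mem_analyticCoeffs hP) h₀] with θ hθ hΘ
  exact (hclear θ (M.GX θ) (hq θ hΘ)).mpr hθ

end NetworkModelSet

/-! ### Disjoint paths and disconnecting sets -/

section Graph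

variable {V : Type*} {E : V → V → Prop}

/-- Disjoint paths have distinct initial vertices, so their number is bounded and the supremum is
attained; for an unbounded set `sSup` would be `0`. -/
theorem maxDisjointPaths_spec [Fintype V] (E : V → V → Prop) (S S' : Set V) :
    HasDisjointPaths E S S' (maxDisjointPaths E S S') := by
  classical
  refine Nat.sSup_mem (s := {k | HasDisjointPaths E S S' k})
    ⟨0, fun s => s.elim0, fun s => s.elim0, fun s => s.elim0⟩ ⟨Fintype.card V, ?_⟩
  rintro k ⟨p, hp, hdisj⟩
  choose a _ _ _ hab using hp
  have ha : ∀ s, a s ∈ p s := fun s => List.mem_of_mem_head? (hab s).2.2.1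
  have hinj : a.Injective := fun s t h => by
    by_contra hst
    exact hdisj s t hst (ha s) (h ▸ ha t)
  simpa using Fintype.card_le_of_injective a hinj

/-- Walks can be shortened to paths. -/
theorem exists_isPath_of_reflTransGen {r : V → V → Prop} {a b : V}
    (h : Relation.ReflTransGen r a b) : ∃ p, IsPath r a b p := by
  classical
  induction h with
  | refl => exact ⟨[a], List.isChain_singleton a, by simp, rfl, rfl⟩
  | @tail c d _ hcd ih =>
    obtain ⟨p, hchain, hnodup, hhead, hlast⟩ := ih
    by_cases hd : d ∈ p
    · obtain ⟨l₁, l₂, rfl⟩ := List.append_of_mem hd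
      have hpre : (l₁ ++ [d]) <+: (l₁ ++ d :: l₂) := ⟨l₂, by simp⟩
      refine ⟨l₁ ++ [d], hchain.prefix hpre, hnodup.sublist hpre.sublist, ?_, by simp⟩
      cases l₁ <;> simpa using hhead
    · refine ⟨p ++ [d], ?_, ?_, ?_, by simp⟩
      · rw [List.isChain_append]
        refine ⟨hchain, List.isChain_singleton d, ?_⟩
        intro x hx y hy
        rw [hlast] at hx
        simp only [Option.mem_def, Option.some.injEq, List.head?_cons] at hx hy
        rwa [← hx, ← hy]
      · rw [List.nodup_append]
        refine ⟨hnodup, by simp, ?_⟩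
        intro x hx y hy hxy
        rw [List.mem_singleton] at hy
        exact hd (hy ▸ hxy ▸ hx)
      · rw [List.head?_append, hhead]; rfl

/-- The vertices on the source side of a disconnecting set. -/
theorem IsDisconnecting.exists_side {S S' D : Set V} (h : IsDisconnecting E S S' D) :
    ∃ B : Set V, (∀ a ∈ S, a ∈ B ∨ a ∈ D) ∧ (∀ u ∈ B, ∀ v, E u v → v ∈ B ∨ v ∈ D) ∧
      (∀ v ∈ B, v ∉ D) ∧ ∀ v ∈ B, v ∉ S' := by
  let r : V → V → Prop := fun u v => E u v ∧ v ∉ D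
  -- The vertices reachable from `S \ D` without meeting `D`.
  refine ⟨{v | ∃ a ∈ S, a ∉ D ∧ Relation.ReflTransGen r a v}, ?_, ?_, ?_, ?_⟩
  · intro a ha
    by_cases haD : a ∈ D
    · exact Or.inr haD
    · exact Or.inl ⟨a, ha, haD, .refl⟩
  · rintro u ⟨a, ha, haD, hau⟩ v huv
    by_cases hvD : v ∈ D
    · exact Or.inr hvD
    · exact Or.inl ⟨a, ha, haD, hau.tail ⟨huv, hvD⟩⟩
  · rintro v ⟨a, ha, haD, hav⟩
    rcases hav.cases_tail with rfl | ⟨c, -, hc⟩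
    exacts [haD, hc.2]
  · rintro v ⟨a, ha, haD, hav⟩ hv
    obtain ⟨p, hchain, hnodup, hhead, hlast⟩ := exists_isPath_of_reflTransGen hav
    obtain ⟨x, hx, hxD⟩ := h a ha v hv p ⟨hchain.imp fun _ _ h => h.1, hnodup, hhead, hlast⟩
    cases p with
    | nil => simp at hx
    | cons y l =>
      simp only [List.head?_cons, Option.some.injEq] at hhead
      subst hhead
      rcases List.mem_cons.mp hx with rfl | hx
      · exact haD hxD
      · obtain ⟨i, hi, rfl⟩ := List.getElem_of_mem hx
        have := List.isChain_iff_getElem.mp hchain i (by simpa using hi)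
        exact this.2 (by simpa using hxD)

end Graph

/-! ### From disjoint paths to regular submatrices -/

namespace NetworkModelSet

variable {L K n : ℕ} {M : NetworkModelSet L K n}

theorem IsAdmissible.GX_diag (hadm : M.IsAdmissible) {θ : Fin n → ℝ} (hθ : θ ∈ M.Θ) (k : Fin L) :
    M.GX θ k (Sum.inl k) = -1 := by
  simp [GX, hadm.hollow θ hθ k]

theorem GX_eq_gain {θ : Fin n → ℝ} {k : Fin L} {v : M.Vert} (h : v ≠ Sum.inl k) :
    M.GX θ k v = M.gain v k θ := by
  rcases v with l | x
  · have : k ≠ l := fun h' => h (h' ▸ rfl)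
    simp [GX, gain, this]
  · rfl

theorem gain_eq_zero {θ : Fin n → ℝ} (hθ : θ ∈ M.Θ) {k : Fin L} {v : M.Vert}
    (h : ¬ M.Edge v (Sum.inl k)) : M.gain v k θ = 0 := by
  by_contra h0
  exact h ⟨k, rfl, fun h1 => h0 (h1 θ hθ)⟩

theorem IsAdmissible.edge_ne (hadm : M.IsAdmissible) {u v : M.Vert} (h : M.Edge u v) : u ≠ v := by
  rintro rfl
  obtain ⟨k, rfl, hk⟩ := h
  exact hk fun θ hθ => hadm.hollow θ hθ k

/-- Let the rows `A` be such that disjoint paths start outside `A` and stay inside `A` afterwards.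
Generically, a vector that solves the network equations in the rows `A`, is supported on `A` and
the initial vertices, and vanishes at the terminal vertices, is zero. -/
theorem generically_eq_zero_of_paths (hadm : M.IsAdmissible) (hpar : M.IndependentlyParameterized)
    (hreg : M.FixedEntriesRegular) (A : Set (Fin L)) {k : ℕ} (p : Fin k → List M.Vert)
    (hne : ∀ s, p s ≠ []) (hchain : ∀ s, (p s).IsChain M.Edge) (hnodup : ∀ s, (p s).Nodup)
    (hdisj : ∀ s t, s ≠ t → (p s).Disjoint (p t))
    (hhead : ∀ s, ∀ a ∈ A, (p s).head (hne s) ≠ Sum.inl a)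
    (htail : ∀ s, ∀ i (hi : i + 1 < (p s).length), ∃ a ∈ A, (p s)[i + 1] = Sum.inl a) :
    M.Generically fun θ => ∀ w : M.Vert → RatFunc ℝ,
      (∀ a ∈ A, (M.GX θ).mulVec w a = 0) →
      (∀ v, (∀ a ∈ A, v ≠ Sum.inl a) → (∀ s, v ≠ (p s).head (hne s)) → w v = 0) →
      (∀ s, w ((p s).getLast (hne s)) = 0) → w = 0 := by
  classical
  have huniq : ∀ s t i j (hi : i < (p s).length) (hj : j < (p t).length),
      (p s)[i] = (p t)[j] → s = t ∧ i = j := by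
    intro s t i j hi hj h
    have hst : s = t := by
      by_contra hst
      exact hdisj s t hst (List.getElem_mem hi) (h ▸ List.getElem_mem hj)
    subst hst
    exact ⟨rfl, (hnodup s).getElem_inj_iff.mp h⟩
  let Q : A → Prop := fun a => ∃ s i, ∃ hi : i + 1 < (p s).length, (p s)[i + 1] = Sum.inl a.1
  -- The row of `a` is paired with the column of its predecessor on a path, or with its own column
  -- (entry `-1`) if it has none. The columns used are `A` and the initial vertices, without the
  -- terminal vertices.
  let g : A → M.Vert := fun a => if h : Q a then
    (p h.choose)[h.choose_spec.choose]'(by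
      have := h.choose_spec.choose_spec.choose; omega) else Sum.inl a.1
  have hg1 : ∀ (a : A) s i (hi : i + 1 < (p s).length), (p s)[i + 1] = Sum.inl a.1 →
      g a = (p s)[i] := by
    intro a s i hi h
    have hQ : Q a := ⟨s, i, hi, h⟩
    simp only [g, dif_pos hQ]
    obtain ⟨h1, h2⟩ := huniq _ _ _ _ hQ.choose_spec.choose_spec.choose hi
      (hQ.choose_spec.choose_spec.choose_spec.trans h.symm)
    have h2' : hQ.choose_spec.choose = i := by omega
    congr 1
    rw [h1]
  have hg2 : ∀ a : A, ¬ Q a → g a = Sum.inl a.1 := fun a h => dif_neg h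
  -- A predecessor on a path is either initial, hence outside `A`, or has a predecessor itself.
  have hmix : ∀ a b : A, Q a → ¬ Q b → g a ≠ g b := by
    rintro a b ⟨s, i, hi, h⟩ hb heq
    rw [hg1 a s i hi h, hg2 b hb] at heq
    cases i with
    | zero => exact hhead s b.1 b.2 (by rw [← heq, List.head_eq_getElem])
    | succ i => exact hb ⟨s, i, by omega, heq⟩
  have hginj : g.Injective := by
    intro a b hab
    by_cases ha : Q a <;> by_cases hb : Q b
    · obtain ⟨s, i, hi, h⟩ := ha
      obtain ⟨t, j, hj, h'⟩ := hb
      rw [hg1 a s i hi h, hg1 b t j hj h'] at hab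
      obtain ⟨rfl, rfl⟩ := huniq _ _ _ _ _ _ hab
      exact Subtype.ext (Sum.inl_injective (h.symm.trans h'))
    · exact absurd hab (hmix a b ha hb)
    · exact absurd hab.symm (hmix b a hb ha)
    · rw [hg2 a ha, hg2 b hb] at hab
      exact Subtype.ext (Sum.inl_injective hab)
  rcases M.Θ.eq_empty_or_nonempty with hΘ | ⟨θ₁, hθ₁⟩
  · exact Filter.Eventually.of_forall fun θ hθ => by simp [hΘ] at hθ
  have hdiag : ∀ a : A, ¬ M.IsFixedZero fun θ => M.GX θ a.1 (g a) := by
    intro a hz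
    by_cases ha : Q a
    · obtain ⟨s, i, hi, h⟩ := ha
      have hedge := List.isChain_iff_getElem.mp (hchain s) i hi
      rw [h] at hedge
      obtain ⟨k', hk', hk⟩ := id hedge
      obtain rfl := Sum.inl_injective hk'
      refine hk fun θ hθ => ?_
      rw [← GX_eq_gain (hadm.edge_ne hedge), ← hg1 a s i hi h]
      exact hz θ hθ
    · have := hz θ₁ hθ₁
      simp only [hg2 a ha, hadm.GX_diag hθ₁] at this
      simp at this
  refine (generically_det_GX_ne_zero hpar hreg Subtype.val_injective hginj hdiag).mono
    fun θ hθ hdet w hrow hsupp hlast => ?_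
  -- `w` is supported on the chosen columns, so the equations in the rows `A` form a square regular
  -- system.
  have hcover : ∀ v, (∀ a, v ≠ g a) → w v = 0 := by
    intro v hv
    by_cases hvp : ∃ s, v ∈ p s
    · obtain ⟨s, hs⟩ := hvp
      obtain ⟨i, hi, rfl⟩ := List.getElem_of_mem hs
      by_cases hi' : i + 1 < (p s).length
      · obtain ⟨a, ha, h⟩ := htail s i hi'
        exact absurd (hg1 ⟨a, ha⟩ s i hi' h).symm (hv ⟨a, ha⟩)
      · have : i = (p s).length - 1 := by omega
        subst this
        rw [← List.getLast_eq_getElem (hne s)]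
        exact hlast s
    · push Not at hvp
      refine hsupp v ?_ ?_
      · rintro a ha rfl
        have : ¬ Q ⟨a, ha⟩ := fun ⟨s, i, hi, h⟩ => hvp s (h ▸ List.getElem_mem hi)
        exact hv ⟨a, ha⟩ (hg2 ⟨a, ha⟩ this).symm
      · rintro s rfl
        exact hvp s (List.head_mem _)
  have hw : (fun a => w (g a)) = 0 := by
    refine Matrix.eq_zero_of_mulVec_eq_zero hdet ?_
    ext1 a
    have h1 := hrow a.1 a.2
    rw [Matrix.mulVec, dotProduct] at h1 ⊢
    refine Eq.trans ?_ h1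
    refine Finset.sum_of_injOn g hginj.injOn (by simp) ?_ (fun _ _ => rfl)
    intro v _ hv
    rw [hcover v fun a ha => hv ⟨a, by simp, ha.symm⟩, mul_zero]
  ext1 v
  by_cases hv : ∃ a, v = g a
  · obtain ⟨a, rfl⟩ := hv
    exact congrFun hw a
  · exact hcover v (not_exists.mp hv)

end NetworkModelSet

/-! ### Bounds for the number of disjoint paths -/

section Graph

variable {V : Type*} {E : V → V → Prop}

theorem HasDisjointPaths.le_card_source {S : Finset V} {S' : Set V} {k : ℕ}
    (h : HasDisjointPaths E S S' k) : k ≤ S.card := by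
  obtain ⟨p, hp, hdisj⟩ := h
  choose a ha _ _ hab using hp
  have hmem : ∀ s, a s ∈ p s := fun s => List.mem_of_mem_head? (hab s).2.2.1
  have hinj : a.Injective := fun s t h => by
    by_contra hst
    exact hdisj s t hst (hmem s) (h ▸ hmem t)
  simpa using Finset.card_le_card_of_injOn (s := Finset.univ) a (fun s _ => ha s) hinj.injOn

theorem HasDisjointPaths.le_card_target {S : Set V} {S' : Finset V} {k : ℕ}
    (h : HasDisjointPaths E S S' k) : k ≤ S'.card := by
  obtain ⟨p, hp, hdisj⟩ := h
  choose _ _ b hb hab using hp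
  have hmem : ∀ s, b s ∈ p s := fun s => List.mem_of_mem_getLast? (hab s).2.2.2
  have hinj : b.Injective := fun s t h => by
    by_contra hst
    exact hdisj s t hst (hmem s) (h ▸ hmem t)
  simpa using Finset.card_le_card_of_injOn (s := Finset.univ) b (fun s _ => hb s) hinj.injOn

/-- The data of a system of disjoint paths, with initial and terminal vertices given by
`List.head` and `List.getLast`. -/
theorem HasDisjointPaths.exists_lists {S S' : Set V} {k : ℕ} (h : HasDisjointPaths E S S' k) :
    ∃ (p : Fin k → List V) (hne : ∀ s, p s ≠ []), (∀ s, (p s).IsChain E) ∧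
      (∀ s, (p s).Nodup) ∧ (∀ s t, s ≠ t → (p s).Disjoint (p t)) ∧
      (∀ s, (p s).head (hne s) ∈ S) ∧ ∀ s, (p s).getLast (hne s) ∈ S' := by
  obtain ⟨p, hp, hdisj⟩ := h
  choose a ha b hb hab using hp
  have hne : ∀ s, p s ≠ [] := fun s hs => by simpa [hs] using (hab s).2.2.1
  refine ⟨p, hne, fun s => (hab s).1, fun s => (hab s).2.1, hdisj, fun s => ?_, fun s => ?_⟩
  · have := (hab s).2.2.1
    rw [List.head?_eq_some_head (hne s), Option.some_inj] at this
    exact this ▸ ha s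
  · have := (hab s).2.2.2
    rw [List.getLast?_eq_some_getLast (hne s), Option.some_inj] at this
    exact this ▸ hb s

end Graph

/-! ### Responses, cuts and measured signals -/

namespace NetworkModelSet

variable {L K n : ℕ} {M : NetworkModelSet L K n}

theorem hasDisjointPaths_b (M : NetworkModelSet L K n) (S S' : Set M.Vert) :
    HasDisjointPaths M.Edge S S' (M.b S S') :=
  maxDisjointPaths_spec _ _ _

/-- The signals caused by the external signals `y`. -/
noncomputable def response (M : NetworkModelSet L K n) (θ : Fin n → ℝ) (y : M.Ext → RatFunc ℝ) :
    M.Vert → RatFunc ℝ :=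
  Sum.elim ((M.TX θ).mulVec y) y

/-- The matrix inverse in `T` is a genuine one only if `I - G` is regular; this follows generically
from its nonzero diagonal. -/
theorem generically_sub_one_mul_T (hadm : M.IsAdmissible) (hpar : M.IndependentlyParameterized)
    (hreg : M.FixedEntriesRegular) : M.Generically fun θ => (M.G θ - 1) * M.T θ = -1 := by
  rcases M.Θ.eq_empty_or_nonempty with hΘ | ⟨θ₁, hθ₁⟩
  · exact Filter.Eventually.of_forall fun θ hθ => by simp [hΘ] at hθ
  refine (generically_det_GX_ne_zero (M := M) hpar hreg (f := id) (g := Sum.inl)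
    Function.injective_id Sum.inl_injective fun k hk => ?_).mono fun θ hθ hdet => ?_
  · have := hk θ₁ hθ₁
    simp only [id, hadm.GX_diag hθ₁] at this
    simp at this
  · have h1 : (M.GX θ).submatrix id Sum.inl = -(1 - M.G θ) := by
      ext1 k l
      simp [GX]
    rw [h1, Matrix.det_neg] at hdet
    have h2 : IsUnit (1 - M.G θ).det := isUnit_iff_ne_zero.mpr (right_ne_zero_of_mul hdet)
    rw [← neg_sub, neg_mul, T, Matrix.mul_nonsing_inv _ h2]

theorem GX_mulVec_response {θ : Fin n → ℝ} (h : (M.G θ - 1) * M.T θ = -1)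
    (y : M.Ext → RatFunc ℝ) : (M.GX θ).mulVec (M.response θ y) = 0 := by
  rw [GX, response, Matrix.fromCols_mulVec_sumElim, Matrix.mulVec_mulVec, TX, ← Matrix.mul_assoc, h,
    Matrix.neg_mul, Matrix.one_mul, Matrix.neg_mulVec, neg_add_cancel]

/-- If there are disjoint paths from `Xb` to `S` that cover `S`, then generically the external
signals in `Xb` can be chosen to yield any given signals at `S`. -/
theorem generically_exists_response (hadm : M.IsAdmissible) (hpar : M.IndependentlyParameterized)
    (hreg : M.FixedEntriesRegular) {Xb : Set M.Ext} {S : Finset M.Vert} {k : ℕ}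
    (hS : S.card ≤ k) (h : HasDisjointPaths M.Edge (M.extV Xb) S k) :
    M.Generically fun θ => ∀ t : M.Vert → RatFunc ℝ, ∃ y : M.Ext → RatFunc ℝ,
      (∀ x ∉ Xb, y x = 0) ∧ ∀ v ∈ S, M.response θ y v = t v := by
  classical
  obtain ⟨p, hne, hchain, hnodup, hdisj, hhead, hlast⟩ := h.exists_lists
  choose x hx hxp using hhead
  have hxinj : x.Injective := fun s t hst => by
    by_contra h
    refine hdisj s t h (List.head_mem (hne s)) ?_
    rw [← hxp s, hst, hxp t]
    exact List.head_mem _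
  have hcover : ∀ v ∈ S, ∃ s, (p s).getLast (hne s) = v := by
    have hinj : Function.Injective fun s => (p s).getLast (hne s) := fun s t hst => by
      by_contra h
      refine hdisj s t h (List.getLast_mem (hne s)) ?_
      rw [show (p s).getLast (hne s) = _ from hst]
      exact List.getLast_mem _
    have := Finset.surj_on_of_inj_on_of_card_le (s := Finset.univ) (t := S)
      (fun s _ => (p s).getLast (hne s)) (fun s _ => hlast s) (fun s t _ _ h => hinj h)
      (by simpa using hS)
    intro v hv
    obtain ⟨s, -, hs⟩ := this v hv
    exact ⟨s, hs.symm⟩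
  refine ((generically_sub_one_mul_T hadm hpar hreg).and
    (generically_eq_zero_of_paths hadm hpar hreg Set.univ p hne hchain hnodup hdisj
      (fun s a _ => by rw [← hxp s]; exact Sum.inr_ne_inl) fun s i hi => ?_)).mono
    fun θ hθ ⟨hT, hker⟩ t => ?_
  · obtain ⟨a, ha, -⟩ := List.isChain_iff_getElem.mp (hchain s) i hi
    exact ⟨a, trivial, ha⟩
  -- `Y` places amplitudes at the initial vertices and the square matrix `N` maps them to the
  -- signals at the terminal vertices. A response that vanishes there is zero by the path lemma, so
  -- `N` is injective, hence surjective.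
  let Y : Matrix M.Ext (Fin k) (RatFunc ℝ) := Matrix.of fun z s => if z = x s then 1 else 0
  have hYx : ∀ c s, Y.mulVec c (x s) = c s := by
    intro c s
    simp [Y, Matrix.mulVec, dotProduct, hxinj.eq_iff]
  have hY0 : ∀ c z, (∀ s, z ≠ x s) → Y.mulVec c z = 0 := by
    intro c z hz
    simp [Y, Matrix.mulVec, dotProduct, hz]
  let N : Matrix (Fin k) (Fin k) (RatFunc ℝ) :=
    (Matrix.fromRows (M.TX θ * Y) Y).submatrix (fun s => (p s).getLast (hne s)) id
  have hN : ∀ c s, N.mulVec c s = M.response θ (Y.mulVec c) ((p s).getLast (hne s)) := by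
    intro c s
    have := Matrix.fromRows_mulVec (M.TX θ * Y) Y c
    rw [← Matrix.mulVec_mulVec] at this
    exact congrFun this ((p s).getLast (hne s))
  have hinj : Function.Injective N.mulVecLin := by
    rw [← LinearMap.ker_eq_bot, LinearMap.ker_eq_bot']
    intro c hc
    have hw := hker (M.response θ (Y.mulVec c))
      (fun a _ => by rw [GX_mulVec_response hT]; rfl)
      (fun v hv hv' => by
        rcases v with a | z
        · exact absurd rfl (hv a trivial)
        · exact hY0 c z fun s hs => hv' s (by rw [← hxp s, hs]))
      (fun s => by rw [← hN]; exact congrFun hc s)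
    ext1 s
    rw [← hYx c s]
    exact congrFun hw (Sum.inr (x s))
  obtain ⟨c, hc⟩ := LinearMap.injective_iff_surjective.mp hinj
    fun s => t ((p s).getLast (hne s))
  refine ⟨Y.mulVec c, fun z hz => hY0 c z fun s hs => hz (hs ▸ hx s), fun v hv => ?_⟩
  obtain ⟨s, rfl⟩ := hcover v hv
  rw [← hN]
  exact congrFun hc s

/-- Signals in `B` can be discarded from an equation that receives no edge from `B`. -/
theorem GX_mulVec_indicator {B : Set M.Vert} {a : Fin L}
    (haB : Sum.inl a ∉ B) (hB : ∀ u ∈ B, ¬ M.Edge u (Sum.inl a)) {θ : Fin n → ℝ} (hθ : θ ∈ M.Θ)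
    (w : M.Vert → RatFunc ℝ) :
    (M.GX θ).mulVec (Bᶜ.indicator w) a = (M.GX θ).mulVec w a := by
  classical
  refine Finset.sum_congr rfl fun v _ => ?_
  change M.GX θ a v * _ = M.GX θ a v * _
  by_cases hv : v ∈ B
  · have hva : v ≠ Sum.inl a := fun h => haB (h ▸ hv)
    rw [GX_eq_gain hva, gain_eq_zero hθ (hB v hv), zero_mul, zero_mul]
  · rw [Set.indicator_of_mem (by exact hv)]

/-- Let no edge lead from `B` out of `B ∪ D`. Generically, a vector that vanishes at `D` and solves
the network equations outside `B ∪ D` vanishes outside `B`. -/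
theorem generically_eq_zero_of_cut (hadm : M.IsAdmissible) (hpar : M.IndependentlyParameterized)
    (hreg : M.FixedEntriesRegular) {B D : Set M.Vert}
    (hB : ∀ u ∈ B, ∀ v, M.Edge u v → v ∈ B ∨ v ∈ D) :
    M.Generically fun θ => ∀ w : M.Vert → RatFunc ℝ,
      (∀ a, Sum.inl a ∉ B → Sum.inl a ∉ D → (M.GX θ).mulVec w a = 0) →
      (∀ x, Sum.inr x ∉ B → Sum.inr x ∉ D → w (Sum.inr x) = 0) →
      (∀ v ∈ D, w v = 0) → ∀ v ∉ B, w v = 0 := by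
  -- No paths are needed: every row is paired with its own column. The lemma is applied to `w` with
  -- its part in `B` discarded.
  refine (generically_eq_zero_of_paths hadm hpar hreg {a | Sum.inl a ∉ B ∧ Sum.inl a ∉ D}
    (k := 0) (fun s => s.elim0) (fun s => s.elim0) (fun s => s.elim0) (fun s => s.elim0)
    (fun s => s.elim0) (fun s => s.elim0) (fun s => s.elim0)).mono
    fun θ hθ h w hrow hext hD v hv => ?_
  have := h (Bᶜ.indicator w) (fun a ha => by
      rw [GX_mulVec_indicator ha.1 (fun u hu he => (hB u hu _ he).elim ha.1 ha.2) hθ]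
      exact hrow a ha.1 ha.2)
    (fun u hu _ => by
      by_cases huB : u ∈ B
      · exact Set.indicator_of_notMem (by simpa using huB) _
      rw [Set.indicator_of_mem (by exact huB)]
      by_cases huD : u ∈ D
      · exact hD u huD
      rcases u with a | x
      · exact absurd rfl (hu a ⟨huB, huD⟩)
      · exact hext x huB huD) (fun s => s.elim0)
  have := congrFun this v
  rwa [Set.indicator_of_mem (by exact hv)] at this

/-- Let no edge lead from `B` out of `B ∪ D`, and let `U ⊇ D` be covered by the initial vertices of
disjoint paths to `Cb`, outside `B`. Generically, a vector that vanishes at `Cb` and solves the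
network equations outside `B ∪ U` vanishes outside `B`. -/
theorem generically_eq_zero_of_measurement (hadm : M.IsAdmissible)
    (hpar : M.IndependentlyParameterized) (hreg : M.FixedEntriesRegular) {B D : Set M.Vert}
    {U : Finset M.Vert} {Cb : Set (Fin L)} {k : ℕ} (hDU : D ⊆ U)
    (hB : ∀ u ∈ B, ∀ v, M.Edge u v → v ∈ B ∨ v ∈ D) (hBC : ∀ c ∈ Cb, Sum.inl c ∉ B)
    (hk : U.card ≤ k) (h : HasDisjointPaths M.Edge U (M.intV Cb) k) :
    (∀ v ∈ U, v ∉ B) ∧ M.Generically fun θ => ∀ w : M.Vert → RatFunc ℝ,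
      (∀ a, Sum.inl a ∉ B → Sum.inl a ∉ U → (M.GX θ).mulVec w a = 0) →
      (∀ x, Sum.inr x ∉ B → Sum.inr x ∉ U → w (Sum.inr x) = 0) →
      (∀ c ∈ Cb, w (Sum.inl c) = 0) → ∀ v ∉ B, w v = 0 := by
  obtain ⟨p, hne, hchain, hnodup, hdisj, hhead, hlast⟩ := h.exists_lists
  have hcover : ∀ v ∈ U, ∃ s, (p s).head (hne s) = v := by
    have hinj : Function.Injective fun s => (p s).head (hne s) := fun s t hst => by
      by_contra h
      refine hdisj s t h (List.head_mem (hne s)) ?_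
      rw [show (p s).head (hne s) = _ from hst]
      exact List.head_mem _
    have := Finset.surj_on_of_inj_on_of_card_le (s := Finset.univ) (t := U)
      (fun s _ => (p s).head (hne s)) (fun s _ => hhead s) (fun s t _ _ h => hinj h)
      (by simpa using hk)
    intro v hv
    obtain ⟨s, -, hs⟩ := this v hv
    exact ⟨s, hs.symm⟩
  -- Every vertex of `U` is already the initial vertex of some path.
  have htailU : ∀ s i (hi : i + 1 < (p s).length), (p s)[i + 1] ∉ U := by
    intro s i hi hU
    obtain ⟨t, ht⟩ := hcover _ hU
    have hst : t = s := by
      by_contra hst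
      exact hdisj t s hst (List.head_mem (hne t)) (ht ▸ List.getElem_mem hi)
    subst hst
    rw [List.head_eq_getElem] at ht
    exact absurd ((hnodup t).getElem_inj_iff.mp ht) (by omega)
  -- A path in `B` could leave only through `D ⊆ U`, which it cannot enter; it would then end in
  -- `B`, away from `Cb`.
  have hpB : ∀ s i (hi : i < (p s).length), (p s)[i] ∉ B := by
    intro s i hi hiB
    have hstep : ∀ d (hd : i + d < (p s).length), (p s)[i + d] ∈ B := by
      intro d
      induction d with
      | zero => exact fun _ => hiB
      | succ d ih =>
        intro hd
        have he := List.isChain_iff_getElem.mp (hchain s) (i + d) hd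
        exact (hB _ (ih (by omega)) _ he).resolve_right fun hD => htailU s (i + d) hd (hDU hD)
    obtain ⟨c, hc, hcl⟩ := hlast s
    refine hBC c hc ?_
    rw [hcl, List.getLast_eq_getElem]
    have hd := hstep ((p s).length - 1 - i) (by omega)
    have h1 : i + ((p s).length - 1 - i) = (p s).length - 1 := by omega
    simpa only [h1] using hd
  refine ⟨fun v hv => ?_, ?_⟩
  · obtain ⟨s, rfl⟩ := hcover v hv
    rw [List.head_eq_getElem]
    exact hpB s 0 _
  refine (generically_eq_zero_of_paths hadm hpar hreg {a | Sum.inl a ∉ B ∧ Sum.inl a ∉ U} p hne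
    hchain hnodup hdisj (fun s a ha h => ha.2 (h ▸ hhead s)) (fun s i hi => ?_)).mono
    fun θ hθ h w hrow hext hC v hv => ?_
  · obtain ⟨a, ha, -⟩ := List.isChain_iff_getElem.mp (hchain s) i hi
    exact ⟨a, ⟨ha ▸ hpB s _ hi, ha ▸ htailU s i hi⟩, ha⟩
  have := h (Bᶜ.indicator w) (fun a ha => by
      rw [GX_mulVec_indicator ha.1
        (fun u hu he => (hB u hu _ he).elim ha.1 fun h => ha.2 (hDU h)) hθ]
      exact hrow a ha.1 ha.2)
    (fun u hu hu' => by
      by_cases huB : u ∈ B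
      · exact Set.indicator_of_notMem (by simpa using huB) _
      rw [Set.indicator_of_mem (by exact huB)]
      have huU : u ∉ U := fun hU => by
        obtain ⟨s, hs⟩ := hcover u hU
        exact hu' s hs.symm
      rcases u with a | x
      · exact absurd rfl (hu a ⟨huB, huU⟩)
      · exact hext x huB huU)
    (fun s => by
      obtain ⟨c, hc, hcl⟩ := hlast s
      rw [← hcl, Set.indicator_of_mem (by exact hBC c hc)]
      exact hC c hc)
  have := congrFun this v
  rwa [Set.indicator_of_mem (by exact hv)] at this

/-- The network equation of `w_k`, if `u` is the only source with a nonzero signal. -/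
theorem GX_mulVec_of_single (hadm : M.IsAdmissible) {θ : Fin n → ℝ} (hθ : θ ∈ M.Θ) {k : Fin L}
    {u : M.Vert} (hu : u ≠ Sum.inl k) {w : M.Vert → RatFunc ℝ}
    (h : ∀ v ≠ u, M.Edge v (Sum.inl k) → w v = 0) :
    (M.GX θ).mulVec w k = M.gain u k θ * w u - w (Sum.inl k) := by
  classical
  rw [Matrix.mulVec, dotProduct, Finset.sum_eq_add_of_mem (Sum.inl k) u (Finset.mem_univ _)
    (Finset.mem_univ _) hu.symm, hadm.GX_diag hθ, GX_eq_gain hu]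
  · ring
  · rintro v - ⟨hvk, hvu⟩
    rw [GX_eq_gain hvk]
    by_cases he : M.Edge v (Sum.inl k)
    · rw [h v hvu he, mul_zero]
    · rw [gain_eq_zero hθ he, zero_mul]

/-- If `G_{ji}` can be recovered from `CTR` for the parameters that satisfy a generic property,
then it is generically a function of `CTR`. -/
theorem determinedByCTR_of_generically {i j : Fin L} {P : (Fin n → ℝ) → Prop}
    (hP : M.Generically P)
    (h : ∀ θ θ', P θ → P θ' → M.CTR θ = M.CTR θ' → M.G θ j i = M.G θ' j i) :
    M.DeterminedByCTR j i := by
  have hF : ∀ Φ, ∃ γ, ∀ θ, P θ → M.CTR θ = Φ → M.G θ j i = γ := by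
    intro Φ
    by_cases hex : ∃ θ, P θ ∧ M.CTR θ = Φ
    · obtain ⟨θ', hθ', rfl⟩ := hex
      exact ⟨_, fun θ hθ hΦ => h θ θ' hθ hθ' hΦ⟩
    · exact ⟨0, fun θ hθ hΦ => absurd ⟨θ, hθ, hΦ⟩ hex⟩
  choose F hF using hF
  exact ⟨F, hP.mono fun θ _ hθ => hF _ θ hθ rfl⟩

/-- Consequently `NMinus` and `NPlus` contain all internal in- and out-neighbors, so the formulas
need no correction for known modules. -/
theorem FixedModulesZero.not_knownEdge (hzero : M.FixedModulesZero) (k l : Fin L) :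
    ¬ M.KnownEdge (Sum.inl l) k := by
  rintro ⟨⟨k', hk', h⟩, hfix⟩
  obtain rfl := Sum.inl_injective hk'
  exact h (hzero _ _ hfix)

theorem FixedModulesZero.mem_NMinus (hzero : M.FixedModulesZero) {j k : Fin L}
    (h : M.Edge (Sum.inl k) (Sum.inl j)) : k ∈ M.NMinus j :=
  ⟨h, fun h' => hzero.not_knownEdge _ _ h'.2⟩

theorem FixedModulesZero.mem_NPlus (hzero : M.FixedModulesZero) {i k : Fin L}
    (h : M.Edge (Sum.inl i) (Sum.inl k)) : k ∈ M.NPlus i :=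
  ⟨h, fun h' => hzero.not_knownEdge _ _ h'.1⟩

theorem exc_eq_of_edge {p : Fin K} {k : Fin L} (h : M.Edge (Sum.inr (Sum.inl p)) (Sum.inl k)) :
    M.exc p = k := by
  obtain ⟨k', hk', h⟩ := h
  obtain rfl := Sum.inl_injective hk'
  by_contra hne
  exact h fun θ _ => by simp [gain, X, hne]

theorem TX_inl (M : NetworkModelSet L K n) (θ : Fin n → ℝ) (k : Fin L) (p : Fin K) :
    M.TX θ k (Sum.inl p) = M.T θ k (M.exc p) := by
  simp [TX, Matrix.mul_apply, X]

theorem coe_insert_eq [DecidableEq M.Vert] (i : Fin L) (D : Finset M.Vert) :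
    ((insert (Sum.inl i) D : Finset M.Vert) : Set M.Vert) = M.intV {i} ∪ D := by
  rw [Finset.coe_insert, Set.insert_eq, intV, Set.image_singleton]

/-- If the internal signals in `N` and `Cb` are disconnected by `D` from the external signals in
`Xb`, then generically these vanish at `N` if they vanish at `Cb`, and they can be chosen to vanish
at `Cb` without vanishing at `w_i`. -/
theorem generically_input (hadm : M.IsAdmissible) (hpar : M.IndependentlyParameterized)
    (hreg : M.FixedEntriesRegular) {i : Fin L} {Xb : Finset M.Ext} {N : Set (Fin L)}
    {Cb : Finset (Fin L)} {D : Finset M.Vert}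
    (hdisc : IsDisconnecting M.Edge (M.extV Xb) (M.intV (N ∪ Cb)) D)
    (hexc : M.b (M.extV Xb) (M.intV {i} ∪ D) = D.card + 1) (hmeas : M.b D (M.intV Cb) = D.card) :
    M.Generically fun θ => (M.G θ - 1) * M.T θ = -1 ∧
      (∀ y : M.Ext → RatFunc ℝ, (∀ x ∉ Xb, y x = 0) → (∀ c ∈ Cb, (M.TX θ).mulVec y c = 0) →
        ∀ k ∈ N, (M.TX θ).mulVec y k = 0) ∧
      ∃ y : M.Ext → RatFunc ℝ, (∀ x ∉ Xb, y x = 0) ∧ (M.TX θ).mulVec y i = 1 ∧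
        ∀ c ∈ Cb, (M.TX θ).mulVec y c = 0 := by
  classical
  obtain ⟨B, hSB, hB, -, hBS⟩ := hdisc.exists_side
  have hpD := M.hasDisjointPaths_b (M.extV Xb) (M.intV {i} ∪ D)
  rw [hexc, ← coe_insert_eq] at hpD
  have hpC := M.hasDisjointPaths_b D (M.intV Cb)
  rw [hmeas] at hpC
  -- Otherwise `{w_i} ∪ D` would be too small for `|D| + 1` disjoint paths.
  have hiD : Sum.inl i ∉ D := fun h => by
    have := hpD.le_card_target
    rw [Finset.insert_eq_of_mem h] at this
    omega
  have hBk : ∀ k ∈ N ∪ Cb, Sum.inl k ∉ B := fun k hk hkB => hBS _ hkB ⟨k, hk, rfl⟩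
  have hext : ∀ y : M.Ext → RatFunc ℝ, (∀ x ∉ Xb, y x = 0) → ∀ x, Sum.inr x ∉ B →
      Sum.inr x ∉ D → y x = 0 := fun y hy x hxB hxD =>
    hy x fun hx => (hSB _ ⟨x, hx, rfl⟩).elim hxB hxD
  have hmeas' := (generically_eq_zero_of_measurement hadm hpar hreg (B := B) (D := D) (U := D)
    (Cb := Cb) subset_rfl hB (fun c hc => hBk c (Or.inr hc)) le_rfl hpC).2
  refine ((generically_sub_one_mul_T hadm hpar hreg).and (hmeas'.and
    ((generically_eq_zero_of_cut hadm hpar hreg hB).and (generically_exists_response hadm hpar hreg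
      (Finset.card_insert_le _ _) hpD)))).mono fun θ hθ ⟨hT, h1, h2, h3⟩ => ⟨hT, ?_, ?_⟩
  · intro y hy hC k hk
    exact h1 (M.response θ y) (fun a _ _ => by rw [GX_mulVec_response hT]; rfl)
      (hext y hy) hC (Sum.inl k) (hBk k (Or.inl hk))
  -- With the value `0` on `D`, everything outside `B` vanishes, including `Cb`.
  · obtain ⟨y, hy, hyt⟩ := h3 fun v => if v = Sum.inl i then 1 else 0
    refine ⟨y, hy, ?_, fun c hc => ?_⟩
    · exact (hyt (Sum.inl i) (Finset.mem_insert_self _ _)).trans (if_pos rfl)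
    · refine h2 (M.response θ y) (fun a _ _ => by rw [GX_mulVec_response hT]; rfl)
        (hext y hy) (fun v hv => ?_) (Sum.inl c) (hBk c (Or.inr hc))
      have hvD : v ∈ D := hv
      rw [hyt v (Finset.mem_insert_of_mem hvD), if_neg]
      exact fun h => hiD (h ▸ hvD)

/-- If `D` disconnects the measured signals `Cb` from the external signals in `Xb` and the
out-neighbors of `w_i` except `w_j`, then generically the response of `Cb` to an injection of `G_{ji}`
at `w_j` can be compensated for by the external signals in `Xb`, and no other injection can. -/
theorem generically_output (hadm : M.IsAdmissible) (hpar : M.IndependentlyParameterized)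
    (hreg : M.FixedEntriesRegular) {i j : Fin L} {Xb : Finset M.Ext}
    {N : Set (Fin L)} {Cb : Finset (Fin L)} {D : Finset M.Vert}
    (hN : ∀ k, k ≠ j → M.Edge (Sum.inl i) (Sum.inl k) → k ∈ N)
    (hdisc : IsDisconnecting M.Edge (M.intV N ∪ M.extV Xb) (M.intV Cb) D)
    (hmeas : M.b (M.intV {j} ∪ D) (M.intV Cb) = D.card + 1)
    (hexc : M.b (M.extV Xb) D = D.card) :
    M.Generically fun θ => (M.G θ - 1) * M.T θ = -1 ∧
      ∀ (α : RatFunc ℝ) (w₀ : Fin L → RatFunc ℝ),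
        (∀ a, Sum.inl a ∉ D →
          (M.G θ - 1).mulVec w₀ a = (if a = j then α else 0) - M.G θ a i) →
        ((∃ y : M.Ext → RatFunc ℝ, (∀ x ∉ Xb, y x = 0) ∧
          ∀ c ∈ Cb, (M.TX θ).mulVec y c = w₀ c) ↔ α = M.G θ j i) := by
  classical
  obtain ⟨B, hSB, hB, -, hBS⟩ := hdisc.exists_side
  have hpC := M.hasDisjointPaths_b (M.intV {j} ∪ D) (M.intV Cb)
  rw [hmeas, ← coe_insert_eq] at hpC
  have hpD := M.hasDisjointPaths_b (M.extV Xb) D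
  rw [hexc] at hpD
  have hjD : Sum.inl j ∉ D := fun h => by
    have := hpC.le_card_source
    rw [Finset.insert_eq_of_mem h] at this
    omega
  have hBC : ∀ c ∈ (Cb : Set (Fin L)), Sum.inl c ∉ B := fun c hc hcB => hBS _ hcB ⟨c, hc, rfl⟩
  obtain ⟨hUB, hmeas'⟩ := generically_eq_zero_of_measurement hadm hpar hreg (B := B) (D := D)
    (U := insert (Sum.inl j) D) (Cb := Cb) (by simp) hB hBC
    (Finset.card_insert_le _ _) hpC
  have hjB : Sum.inl j ∉ B := hUB _ (Finset.mem_insert_self _ _)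
  refine ((generically_sub_one_mul_T hadm hpar hreg).and (hmeas'.and
    ((generically_eq_zero_of_cut hadm hpar hreg hB).and
      (generically_exists_response hadm hpar hreg le_rfl hpD)))).mono
    fun θ hθ ⟨hT, h1, h2, h3⟩ => ⟨hT, fun α w₀ hw₀ => ?_⟩
  have hG : ∀ a, a ≠ j → Sum.inl a ∉ B → Sum.inl a ∉ D → M.G θ a i = 0 := fun a haj haB haD =>
    gain_eq_zero (M := M) (v := Sum.inl i) hθ fun he =>
      (hSB (Sum.inl a) (Or.inl ⟨a, hN a haj he, rfl⟩)).elim haB haD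
  -- The difference of `w₀` and a response satisfies the same inhomogeneous equations as `w₀`;
  -- outside `B ∪ D` only the one at `w_j` can have a nonzero right-hand side, namely `α - G_{ji}`.
  have hGX : ∀ y, (M.GX θ).mulVec (Sum.elim w₀ 0 - M.response θ y) = (M.G θ - 1).mulVec w₀ := by
    intro y
    rw [Matrix.mulVec_sub, GX_mulVec_response hT, sub_zero, GX, Matrix.fromCols_mulVec_sumElim,
      Matrix.mulVec_zero, add_zero]
  have hext : ∀ y : M.Ext → RatFunc ℝ, (∀ x ∉ Xb, y x = 0) → ∀ x, Sum.inr x ∉ B →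
      Sum.inr x ∉ D → (Sum.elim w₀ 0 - M.response θ y : M.Vert → RatFunc ℝ) (Sum.inr x) = 0 := by
    intro y hy x hxB hxD
    have := hy x fun hx => (hSB (Sum.inr x) (Or.inr ⟨x, hx, rfl⟩)).elim hxB hxD
    rw [Pi.sub_apply, response, Sum.elim_inr, Sum.elim_inr, this, Pi.zero_apply, sub_zero]
  constructor
  · rintro ⟨y, hy, hC⟩
    have hw := h1 (Sum.elim w₀ 0 - M.response θ y) (fun a haB haU => by
        rw [Finset.mem_insert, not_or] at haU
        have haj : a ≠ j := fun h => haU.1 (h ▸ rfl)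
        rw [hGX, hw₀ a haU.2, if_neg haj, hG a haj haB haU.2, sub_zero])
      (fun x hxB hxU => hext y hy x hxB fun h => hxU (Finset.mem_insert_of_mem h))
      (fun c hc => sub_eq_zero.mpr (hC c hc).symm)
    -- The equation of `w_j` receives nothing from `B`, and everything outside `B` is zero; its
    -- right-hand side must therefore vanish.
    have hrow := GX_mulVec_indicator hjB (fun u hu he => (hB u hu _ he).elim hjB hjD) hθ
      (Sum.elim w₀ 0 - M.response θ y)
    have hzero : Bᶜ.indicator (Sum.elim w₀ 0 - M.response θ y) = 0 := by
      ext1 v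
      by_cases hv : v ∈ B
      · exact Set.indicator_of_notMem (by simpa using hv) _
      · rw [Set.indicator_of_mem (by exact hv)]
        exact hw v hv
    rw [hzero, Matrix.mulVec_zero, hGX, hw₀ j hjD, if_pos rfl] at hrow
    exact sub_eq_zero.mp hrow.symm
  · rintro rfl
    -- The excitations reproduce `w₀` on `D`; the difference then vanishes beyond the cut.
    obtain ⟨y, hy, hyt⟩ := h3 (Sum.elim w₀ 0)
    refine ⟨y, hy, fun c hc => ?_⟩
    have := h2 (Sum.elim w₀ 0 - M.response θ y) (fun a haB haD => by
        rw [hGX, hw₀ a haD]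
        by_cases haj : a = j
        · rw [if_pos haj, haj, sub_self]
        · rw [if_neg haj, hG a haj haB haD, sub_zero])
      (hext y hy) (fun v hv => by rw [Pi.sub_apply, hyt v hv, sub_self]) (Sum.inl c) (hBC c hc)
    exact (sub_eq_zero.mp this).symm

/-! #### Identification formulas -/

/-- The extension by zero of a vector of external signals. -/
noncomputable def zeroExtend {Xb : Finset M.Ext} (y : Xb → RatFunc ℝ) : M.Ext → RatFunc ℝ :=
  open Classical in fun x => if h : x ∈ Xb then y ⟨x, h⟩ else 0

theorem zeroExtend_of_notMem {Xb : Finset M.Ext} (y : Xb → RatFunc ℝ) :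
    ∀ x ∉ Xb, zeroExtend y x = 0 :=
  fun _ hx => dif_neg hx

theorem dotProduct_zeroExtend {Xb : Finset M.Ext} (r : M.Ext → RatFunc ℝ) (y : Xb → RatFunc ℝ) :
    r ⬝ᵥ zeroExtend y = (fun x : Xb => r x) ⬝ᵥ y := by
  classical
  rw [dotProduct, ← Finset.sum_subset (Finset.subset_univ Xb)
    fun x _ hx => by rw [zeroExtend_of_notMem y x hx, mul_zero], ← Finset.sum_coe_sort]
  exact Finset.sum_congr rfl fun x _ => by simp [zeroExtend]

theorem zeroExtend_restrict {Xb : Finset M.Ext} {y : M.Ext → RatFunc ℝ}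
    (hy : ∀ x ∉ Xb, y x = 0) : zeroExtend (fun x : Xb => y x) = y := by
  ext1 x
  by_cases hx : x ∈ Xb
  · exact dif_pos hx
  · rw [zeroExtend_of_notMem _ x hx, hy x hx]

/-- The external signals in `Xb` that vanish at `Cb` and have the unit value under `r` exist and
yield the signal `γ` at `w_j`. -/
def InputFormula (M : NetworkModelSet L K n) (θ : Fin n → ℝ) (r : M.Ext → RatFunc ℝ)
    (Xb : Finset M.Ext) (Cb : Finset (Fin L)) (j : Fin L) (γ : RatFunc ℝ) : Prop :=
  (∃ y : M.Ext → RatFunc ℝ, (∀ x ∉ Xb, y x = 0) ∧ r ⬝ᵥ y = 1 ∧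
    ∀ c ∈ Cb, (M.TX θ).mulVec y c = 0) ∧
  ∀ y : M.Ext → RatFunc ℝ, (∀ x ∉ Xb, y x = 0) → r ⬝ᵥ y = 1 →
    (∀ c ∈ Cb, (M.TX θ).mulVec y c = 0) → (M.TX θ).mulVec y j = γ

/-- Existence puts `firstUnit` in the range of `A`, so `B` maps it to a particular solution; all
solutions give the same signal at `w_j`. -/
theorem InputFormula.eq_of_isGeneralizedInverse {θ : Fin n → ℝ} {r : M.Ext → RatFunc ℝ}
    {Xb : Finset M.Ext} {Cb : Finset (Fin L)} {j : Fin L} {γ : RatFunc ℝ}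
    (h : M.InputFormula θ r Xb Cb j γ) {A : Matrix (Unit ⊕ Cb) Xb (RatFunc ℝ)}
    (hA : A = Matrix.fromRows (Matrix.of fun _ (x : Xb) => r x)
      ((M.TX θ).submatrix Subtype.val Subtype.val))
    {B : Matrix Xb (Unit ⊕ Cb) (RatFunc ℝ)} (hB : IsGeneralizedInverse A B) :
    γ = Matrix.vecMul (fun x : Xb => M.TX θ j x) B ⬝ᵥ firstUnit := by
  obtain ⟨⟨y, hy, hy1, hyC⟩, hγ⟩ := h
  have hA1 : ∀ y u, A.mulVec y (Sum.inl u) = r ⬝ᵥ zeroExtend y := by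
    intro y u
    rw [dotProduct_zeroExtend, hA]
    rfl
  have hA2 : ∀ y c, A.mulVec y (Sum.inr c) = (M.TX θ).mulVec (zeroExtend y) c := by
    intro y c
    rw [Matrix.mulVec, Matrix.mulVec, dotProduct_zeroExtend, hA]
    rfl
  have hAy : A.mulVec (fun x : Xb => y x) = firstUnit := by
    ext1 (u | c)
    · rw [hA1, zeroExtend_restrict hy, hy1]; rfl
    · rw [hA2, zeroExtend_restrict hy, hyC c c.2]; rfl
  have hAB := hB.mulVec_mulVec (fun x : Xb => y x)
  rw [hAy] at hAB
  rw [← Matrix.dotProduct_mulVec, ← dotProduct_zeroExtend]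
  refine (hγ _ (zeroExtend_of_notMem _) ?_ fun c hc => ?_).symm
  · rw [← hA1 _ (), hAB]; rfl
  · rw [← hA2 _ ⟨c, hc⟩, hAB]; rfl

/-- `γ` is the unique injection at `w_j` that, together with external signals in `Xb`, yields the
signals `v` at `Cb`. -/
def OutputFormula (M : NetworkModelSet L K n) (θ : Fin n → ℝ) (j : Fin L) (Xb : Finset M.Ext)
    (Cb : Finset (Fin L)) (v : Fin L → RatFunc ℝ) (γ : RatFunc ℝ) : Prop :=
  ∀ α, (∃ y : M.Ext → RatFunc ℝ, (∀ x ∉ Xb, y x = 0) ∧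
    ∀ c ∈ Cb, M.T θ c j * α + (M.TX θ).mulVec y c = v c) ↔ α = γ

/-- The system is solvable, so `B` applied to `v` solves it, and the first component of every
solution is `γ`. -/
theorem OutputFormula.eq_of_isGeneralizedInverse {θ : Fin n → ℝ} {j : Fin L}
    {Xb : Finset M.Ext} {Cb : Finset (Fin L)} {v : Fin L → RatFunc ℝ} {γ : RatFunc ℝ}
    (h : M.OutputFormula θ j Xb Cb v γ) {B : Matrix (Unit ⊕ Xb) Cb (RatFunc ℝ)}
    (hB : IsGeneralizedInverse (M.stackOutput θ j Xb Cb) B) :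
    γ = firstUnit ⬝ᵥ B.mulVec (fun c : Cb => v c) := by
  have hA : ∀ z c, (M.stackOutput θ j Xb Cb).mulVec z c =
      M.T θ c j * z (Sum.inl ()) + (M.TX θ).mulVec (zeroExtend fun x => z (Sum.inr x)) c := by
    intro z c
    have hTX : (M.TX θ).mulVec (zeroExtend fun x => z (Sum.inr x)) c =
        ∑ x : Xb, M.TX θ c x * z (Sum.inr x) :=
      dotProduct_zeroExtend (M.TX θ c) fun x => z (Sum.inr x)
    rw [hTX, Matrix.mulVec, dotProduct, Fintype.sum_sum_type]
    simp [stackOutput]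
  obtain ⟨y, hy, hyC⟩ := (h γ).mpr rfl
  have hAv : (M.stackOutput θ j Xb Cb).mulVec (Sum.elim (fun _ => γ) fun x => y x) =
      fun c : Cb => v c := by
    ext1 c
    rw [hA, ← hyC c c.2]
    simp only [Sum.elim_inl, Sum.elim_inr, zeroExtend_restrict hy]
  have hAB := hB.mulVec_mulVec (Sum.elim (fun _ => γ) fun x => y x)
  rw [hAv] at hAB
  have hfirst : ∀ z : Unit ⊕ Xb → RatFunc ℝ, firstUnit ⬝ᵥ z = z (Sum.inl ()) := by
    intro z
    rw [dotProduct, Fintype.sum_sum_type]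
    simp [firstUnit]
  rw [hfirst]
  refine ((h _).mp ⟨_, zeroExtend_of_notMem fun x => B.mulVec (fun c : Cb => v c) (Sum.inr x),
    fun c hc => ?_⟩).symm
  rw [← hA _ ⟨c, hc⟩, hAB]

theorem mulVec_TX_eq_of_CTR_eq {θ θ' : Fin n → ℝ} (h : M.CTR θ = M.CTR θ') {Xb : Finset M.Ext}
    (hXb : M.OnlyR Xb) {y : M.Ext → RatFunc ℝ} (hy : ∀ x ∉ Xb, y x = 0) {c : Fin L}
    (hc : c ∈ M.C) : (M.TX θ).mulVec y c = (M.TX θ').mulVec y c := by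
  refine Finset.sum_congr rfl fun x _ => ?_
  by_cases hx : x ∈ Xb
  · obtain ⟨p, rfl⟩ := hXb x hx
    exact congrArg (· * _) (congrFun (congrFun h ⟨c, hc⟩) p)
  · rw [hy x hx, mul_zero, mul_zero]

/-- An `r`-signal enters with unit gain, so the column of `T` at the excited signal is a column of
`TR`. -/
theorem T_eq_of_CTR_eq {θ θ' : Fin n → ℝ} (h : M.CTR θ = M.CTR θ') {x : M.Ext} {k : Fin L}
    (hx : M.Excites x k) (hxr : ∃ p : Fin K, x = Sum.inl p) {c : Fin L} (hc : c ∈ M.C) :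
    M.T θ c k = M.T θ' c k := by
  obtain ⟨p, rfl⟩ := hxr
  obtain rfl := exc_eq_of_edge hx.1.1
  rw [← TX_inl, ← TX_inl]
  exact congrFun (congrFun h ⟨c, hc⟩) p

/-! #### The four cases -/

theorem CondMeasured.generically_inputFormula (hadm : M.IsAdmissible)
    (hpar : M.IndependentlyParameterized) (hreg : M.FixedEntriesRegular)
    (hzero : M.FixedModulesZero) {i j : Fin L} (hij : i ≠ j) {Xb : Finset M.Ext}
    {Cb : Finset (Fin L)} {D : Finset M.Vert} (h : M.CondMeasured i j Xb Cb D)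
    (hXj : ∀ x ∈ Xb, ¬ M.Edge (Sum.inr x) (Sum.inl j)) :
    M.Generically fun θ => M.InputFormula θ (M.TX θ i) Xb Cb j (M.G θ j i) := by
  refine (generically_input hadm hpar hreg h.disconnecting h.excitation h.measurement).mono
    fun θ hθ ⟨hT, h1, h2⟩ => ⟨h2, fun y hy hyi hyC => ?_⟩
  have hrow := GX_mulVec_of_single hadm hθ (k := j) (u := Sum.inl i)
    (fun h => hij (Sum.inl_injective h)) (w := M.response θ y) ?_
  · rw [GX_mulVec_response hT] at hrow
    have hyi' : M.response θ y (Sum.inl i) = 1 := hyi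
    rw [hyi', mul_one] at hrow
    exact (sub_eq_zero.mp hrow.symm).symm
  · rintro (k | x) hv he
    · exact h1 y hy hyC k ⟨hzero.mem_NMinus he, fun hk => hv (by rw [hk])⟩
    · exact hy x fun hx => hXj x hx he

theorem CondUnmeasuredInput.generically_inputFormula (hadm : M.IsAdmissible)
    (hpar : M.IndependentlyParameterized) (hreg : M.FixedEntriesRegular)
    (hzero : M.FixedModulesZero) {i j : Fin L} (hij : i ≠ j) {p : Fin K} {Xb : Finset M.Ext}
    {Cb : Finset (Fin L)} {D : Finset M.Vert} (h : M.CondUnmeasuredInput i j (Sum.inl p) Xb Cb D)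
    (hXj : ∀ x ∈ Xb, ¬ M.Edge (Sum.inr x) (Sum.inl j)) :
    M.Generically fun θ => M.InputFormula θ
      (fun x => if x = Sum.inl p then 1 else 0) (Xb ∪ {Sum.inl p}) Cb j (M.G θ j i) := by
  have hdisc := h.disconnecting
  have hexc := h.excitation
  rw [Set.union_comm (D : Set M.Vert), add_comm 1] at hexc
  rw [← Finset.coe_singleton, ← Finset.coe_union] at hdisc hexc
  have hp := exc_eq_of_edge h.input_excited.1.1
  have hr : ∀ y : M.Ext → RatFunc ℝ,
      (fun x => if x = Sum.inl p then (1 : RatFunc ℝ) else 0) ⬝ᵥ y = y (Sum.inl p) := by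
    intro y
    simp [dotProduct]
  refine (generically_input hadm hpar hreg (Xb := Xb ∪ {Sum.inl p})
    hdisc hexc h.measurement).mono
    fun θ hθ ⟨hT, h1, h2⟩ => ?_
  -- In the equation of `w_i` all in-neighbors vanish, no other `r`-signal enters, and noise does
  -- not act on unmeasured signals.
  have hwi : ∀ y : M.Ext → RatFunc ℝ, (∀ x ∉ Xb ∪ {Sum.inl p}, y x = 0) →
      (∀ c ∈ Cb, (M.TX θ).mulVec y c = 0) → y (Sum.inl p) = (M.TX θ).mulVec y i := by
    intro y hy hyC
    have hrow := GX_mulVec_of_single hadm hθ (k := i) (u := Sum.inr (Sum.inl p))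
      Sum.inr_ne_inl (w := M.response θ y) ?_
    · have hgain : M.gain (Sum.inr (Sum.inl p)) i θ = 1 := by simp [gain, X, hp]
      rw [GX_mulVec_response hT, hgain, one_mul] at hrow
      exact sub_eq_zero.mp hrow.symm
    · rintro (k | q | e) hv he
      · exact h1 y hy hyC k (Or.inl he)
      · have := M.exc.injective ((exc_eq_of_edge he).trans hp.symm)
        exact absurd (by rw [this]) hv
      · obtain ⟨k, hk, hne⟩ := he
        obtain rfl := Sum.inl_injective hk
        exact absurd (fun θ _ => by simp [gain, X, h.input_unmeasured]) hne
  refine ⟨?_, fun y hy hyp hyC => ?_⟩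
  · obtain ⟨y, hy, hyi, hyC⟩ := h2
    exact ⟨y, hy, by rw [hr, hwi y hy hyC, hyi], hyC⟩
  · rw [hr, hwi y hy hyC] at hyp
    have hrow := GX_mulVec_of_single hadm hθ (k := j) (u := Sum.inl i)
      (fun h => hij (Sum.inl_injective h)) (w := M.response θ y) ?_
    · rw [GX_mulVec_response hT] at hrow
      have hyi' : M.response θ y (Sum.inl i) = 1 := hyp
      rw [hyi', mul_one] at hrow
      exact (sub_eq_zero.mp hrow.symm).symm
    · rintro (k | x) hv he
      · exact h1 y hy hyC k (Or.inr ⟨hzero.mem_NMinus he, fun hk => hv (by rw [hk])⟩)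
      · refine hy x fun hx => ?_
        rcases Finset.mem_union.mp hx with hx | hx
        · exact hXj x hx he
        · rw [Finset.mem_singleton.mp hx] at he
          exact hij (Sum.inl_injective (h.input_excited.2 _ he)).symm

theorem CondExcited.generically_outputFormula (hadm : M.IsAdmissible)
    (hpar : M.IndependentlyParameterized) (hreg : M.FixedEntriesRegular)
    (hzero : M.FixedModulesZero) {i j : Fin L} {xi xj : M.Ext} {Xb : Finset M.Ext}
    {Cb : Finset (Fin L)} {D : Finset M.Vert} (h : M.CondExcited i j xi xj Xb Cb D)
    (hiC : i ∉ Cb) :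
    M.Generically fun θ =>
      M.OutputFormula θ j Xb Cb (fun c => M.T θ c i) (M.G θ j i) := by
  refine (generically_output hadm hpar hreg (N := M.NPlus i \ {j})
    (fun k hkj he => ⟨hzero.mem_NPlus he, hkj⟩) h.disconnecting h.measurement h.excitation).mono
    fun θ hθ ⟨hT, hα⟩ α => ?_
  -- This `w₀` satisfies `(G - I) w₀ = α e_j - G e_i`; the term `-e_i` is invisible at `Cb` because
  -- `i ∉ Cb`.
  rw [← hα α ((M.T θ).mulVec (Pi.single i 1) - α • (M.T θ).mulVec (Pi.single j 1) -
    Pi.single i 1) fun a _ => ?_]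
  · refine exists_congr fun y => and_congr_right fun _ => forall₂_congr fun c hc => ?_
    have hci : c ≠ i := fun h => hiC (h ▸ hc)
    simp only [Matrix.mulVec_single_one, Pi.sub_apply, Pi.smul_apply, Matrix.col_apply,
      Pi.single_eq_of_ne hci, smul_eq_mul, sub_zero]
    constructor <;> intro h <;> linear_combination h
  · rw [Matrix.mulVec_sub, Matrix.mulVec_sub, Matrix.mulVec_smul, Matrix.mulVec_mulVec,
      Matrix.mulVec_mulVec, hT, Matrix.sub_mulVec, Matrix.neg_mulVec, Matrix.neg_mulVec]
    simp only [Matrix.one_mulVec, Matrix.mulVec_single_one (M.G θ), Pi.sub_apply, Pi.smul_apply,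
      Pi.neg_apply, Matrix.col_apply, smul_eq_mul, Pi.single_apply]
    split_ifs <;> ring

theorem CondUnmeasuredOutput.generically_outputFormula (hadm : M.IsAdmissible)
    (hpar : M.IndependentlyParameterized) (hreg : M.FixedEntriesRegular)
    (hzero : M.FixedModulesZero) {i j : Fin L} {xj : M.Ext} {Xb : Finset M.Ext}
    {Cb : Finset (Fin L)} {D : Finset M.Vert} (h : M.CondUnmeasuredOutput i j xj Xb Cb D) :
    M.Generically fun θ =>
      M.OutputFormula θ j Xb Cb (fun c => if c = i then 1 else 0) (-M.G θ j i) := by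
  -- `w_i` is both a source and a target, so the path consisting of `w_i` alone must meet `D`.
  have hiD : Sum.inl i ∈ D := by
    obtain ⟨v, hv, hvD⟩ := h.disconnecting (Sum.inl i) (Or.inl ⟨i, Or.inr rfl, rfl⟩) (Sum.inl i)
      ⟨i, h.input_mem, rfl⟩ [Sum.inl i] ⟨List.isChain_singleton _, by simp, rfl, rfl⟩
    rwa [List.mem_singleton.mp hv] at hvD
  refine (generically_output hadm hpar hreg
    (fun k hkj he => Or.inl ⟨hzero.mem_NPlus he, hkj⟩) h.disconnecting h.measurement
    h.excitation).mono fun θ hθ ⟨hT, hα⟩ β => ?_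
  -- Here `(G - I) w₀ = -β e_j - G e_i + e_i`, and the extra `e_i` sits at a vertex of `D`, where no
  -- equation is required.
  rw [← neg_eq_iff_eq_neg, ← hα (-β) (β • (M.T θ).mulVec (Pi.single j 1) -
    Pi.single i 1) fun a ha => ?_]
  -- The compensating excitations change sides, hence sign.
  · rw [← (Equiv.neg (M.Ext → RatFunc ℝ)).exists_congr_right]
    refine exists_congr fun y => and_congr ?_ (forall₂_congr fun c hc => ?_)
    · simp
    · simp only [Matrix.mulVec_single_one, Pi.sub_apply, Pi.smul_apply, Matrix.col_apply,
        Pi.single_apply, smul_eq_mul, Equiv.neg_apply, Matrix.mulVec_neg, Pi.neg_apply]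
      constructor <;> intro h <;> linear_combination -h
  · have hai : a ≠ i := fun h => ha (h ▸ hiD)
    rw [Matrix.mulVec_sub, Matrix.mulVec_smul, Matrix.mulVec_mulVec, hT, Matrix.sub_mulVec,
      Matrix.neg_mulVec]
    simp only [Matrix.one_mulVec, Matrix.mulVec_single_one (M.G θ), Pi.sub_apply, Pi.smul_apply,
      Pi.neg_apply, Matrix.col_apply, smul_eq_mul, Pi.single_apply, if_neg hai]
    split_ifs <;> ring

theorem OnlyR.mono {S S' : Finset M.Ext} (h : M.OnlyR S') (hS : S ⊆ S') : M.OnlyR S :=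
  fun x hx => h x (hS hx)

/-- A solution `y` at `θ` is also one at any `θ'` with the same `CTR`, and produces the same signal
at `w_j`. -/
theorem determinedByCTR_of_inputFormula {i j : Fin L} {r : (Fin n → ℝ) → M.Ext → RatFunc ℝ}
    {Xb : Finset M.Ext} {Cb : Finset (Fin L)} (hXb : M.OnlyR Xb) (hCb : Cb ⊆ M.C) (hj : j ∈ M.C)
    (hr : ∀ θ θ', M.CTR θ = M.CTR θ' → ∀ y : M.Ext → RatFunc ℝ, (∀ x ∉ Xb, y x = 0) →
      r θ ⬝ᵥ y = r θ' ⬝ᵥ y)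
    (h : M.Generically fun θ => M.InputFormula θ (r θ) Xb Cb j (M.G θ j i)) :
    M.DeterminedByCTR j i := by
  refine determinedByCTR_of_generically h fun θ θ' hθ hθ' hCTR => ?_
  obtain ⟨y, hy, hy1, hyC⟩ := hθ.1
  rw [← hθ.2 y hy hy1 hyC, mulVec_TX_eq_of_CTR_eq hCTR hXb hy hj]
  exact hθ'.2 y hy (by rw [← hr θ θ' hCTR y hy, hy1])
    fun c hc => by rw [← mulVec_TX_eq_of_CTR_eq hCTR hXb hy (hCb hc), hyC c hc]

/-- The solution belonging to `γ θ` also solves the system at `θ'`, and uniqueness there gives `γ θ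
= γ θ'`. -/
theorem determinedByCTR_of_outputFormula {i j : Fin L} {γ : (Fin n → ℝ) → RatFunc ℝ}
    {v : (Fin n → ℝ) → Fin L → RatFunc ℝ} {xj : M.Ext} {Xb : Finset M.Ext} {Cb : Finset (Fin L)}
    (hXb : M.OnlyR Xb) (hxj : M.Excites xj j) (hxjr : ∃ p : Fin K, xj = Sum.inl p)
    (hCb : Cb ⊆ M.C)
    (hv : ∀ θ θ', M.CTR θ = M.CTR θ' → ∀ c ∈ Cb, v θ c = v θ' c)
    (hγ : ∀ θ θ', γ θ = γ θ' → M.G θ j i = M.G θ' j i)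
    (h : M.Generically fun θ => M.OutputFormula θ j Xb Cb (v θ) (γ θ)) :
    M.DeterminedByCTR j i := by
  refine determinedByCTR_of_generically h fun θ θ' hθ hθ' hCTR => hγ θ θ' ?_
  obtain ⟨y, hy, hyC⟩ := (hθ (γ θ)).mpr rfl
  refine (hθ' (γ θ)).mp ⟨y, hy, fun c hc => ?_⟩
  rw [← T_eq_of_CTR_eq hCTR hxj hxjr (hCb hc), ← mulVec_TX_eq_of_CTR_eq hCTR hXb hy (hCb hc),
    hyC c hc, hv θ θ' hCTR c hc]

end NetworkModelSet

end DynNet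

theorem mainTheorem12 {L K n : ℕ} (M : DynNet.NetworkModelSet L K n)
    (hadm : M.IsAdmissible) (hspec : M.FullRankSpectrum)
    (hpar : M.IndependentlyParameterized) (hft : M.FeedThrough)
    (hreg : M.FixedEntriesRegular) (hzero : M.FixedModulesZero)
    (i j : Fin L) (hij : i ≠ j) :
    -- input and output measured
    (∀ (Xb : Finset M.Ext) (Cb : Finset (Fin L)) (D : Finset M.Vert),
      M.CondMeasured i j Xb Cb D → Sum.inl j ∉ D →
      (∀ x ∈ Xb, ¬ M.Edge (Sum.inr x) (Sum.inl j)) →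
      (M.Generically fun θ =>
        (∃ B, DynNet.IsGeneralizedInverse (M.stackInput θ i Xb Cb) B) ∧
        ∀ B, DynNet.IsGeneralizedInverse (M.stackInput θ i Xb Cb) B →
          M.G θ j i =
            Matrix.vecMul (fun x : Xb => M.TX θ j x) B ⬝ᵥ DynNet.firstUnit) ∧
      (M.OnlyR Xb → M.DeterminedByCTR j i)) ∧
    -- input and output excited
    (∀ (xi xj : M.Ext) (Xb : Finset M.Ext) (Cb : Finset (Fin L)) (D : Finset M.Vert),
      M.CondExcited i j xi xj Xb Cb D → Sum.inl i ∉ D → i ∉ Cb →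
      (M.Generically fun θ =>
        (∃ B, DynNet.IsGeneralizedInverse (M.stackOutput θ j Xb Cb) B) ∧
        ∀ B, DynNet.IsGeneralizedInverse (M.stackOutput θ j Xb Cb) B →
          M.G θ j i =
            DynNet.firstUnit ⬝ᵥ Matrix.mulVec B (fun c : Cb => M.T θ c i)) ∧
      (M.OnlyR (Xb ∪ {xi, xj}) → M.DeterminedByCTR j i)) ∧
    -- input unmeasured but excited by the measured signal `r_p`, output measured
    (∀ (p : Fin K) (Xb : Finset M.Ext) (Cb : Finset (Fin L)) (D : Finset M.Vert),
      M.CondUnmeasuredInput i j (Sum.inl p) Xb Cb D → Sum.inl j ∉ D →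
      (∀ x ∈ Xb, ¬ M.Edge (Sum.inr x) (Sum.inl j)) →
      (M.Generically fun θ =>
        (∃ B, DynNet.IsGeneralizedInverse
          (M.stackExcitation θ (Sum.inl p) (Xb ∪ {Sum.inl p}) Cb) B) ∧
        ∀ B, DynNet.IsGeneralizedInverse
          (M.stackExcitation θ (Sum.inl p) (Xb ∪ {Sum.inl p}) Cb) B →
          M.G θ j i =
            Matrix.vecMul (fun x : ↥(Xb ∪ {Sum.inl p}) => M.TX θ j x) B ⬝ᵥ
              DynNet.firstUnit) ∧
      (M.OnlyR Xb → M.DeterminedByCTR j i)) ∧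
    -- input measured, output unmeasured but excited
    (∀ (xj : M.Ext) (Xb : Finset M.Ext) (Cb : Finset (Fin L)) (D : Finset M.Vert),
      M.CondUnmeasuredOutput i j xj Xb Cb D →
      (M.Generically fun θ =>
        (∃ B, DynNet.IsGeneralizedInverse (M.stackOutput θ j Xb Cb) B) ∧
        ∀ B, DynNet.IsGeneralizedInverse (M.stackOutput θ j Xb Cb) B →
          M.G θ j i =
            -(DynNet.firstUnit ⬝ᵥ
              Matrix.mulVec B (fun c : Cb => if (c : Fin L) = i then 1 else 0))) ∧
      (M.OnlyR (Xb ∪ {xj}) → M.DeterminedByCTR j i)) := by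
  refine ⟨fun Xb Cb D h _ hX => ?_, fun xi xj Xb Cb D h _ hiC => ?_, fun p Xb Cb D h _ hX => ?_,
    fun xj Xb Cb D h => ?_⟩
  · have hgen := h.generically_inputFormula hadm hpar hreg hzero hij hX
    refine ⟨hgen.mono fun θ _ hθ => ⟨DynNet.exists_isGeneralizedInverse _, fun B hB =>
      hθ.eq_of_isGeneralizedInverse rfl hB⟩, fun hR => ?_⟩
    exact DynNet.NetworkModelSet.determinedByCTR_of_inputFormula hR
      (h.Cb_sub.trans Finset.sdiff_subset) h.output_measured
      (fun θ θ' hCTR y hy => DynNet.NetworkModelSet.mulVec_TX_eq_of_CTR_eq hCTR hR hy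
        h.input_measured) hgen
  · have hgen := h.generically_outputFormula hadm hpar hreg hzero hiC
    refine ⟨hgen.mono fun θ _ hθ => ⟨DynNet.exists_isGeneralizedInverse _, fun B hB =>
      hθ.eq_of_isGeneralizedInverse hB⟩, fun hR => ?_⟩
    exact DynNet.NetworkModelSet.determinedByCTR_of_outputFormula
      (γ := fun θ => M.G θ j i) (v := fun θ c => M.T θ c i)
      (hR.mono Finset.subset_union_left) h.output_excited (hR xj (by simp)) h.Cb_sub
      (fun θ θ' hCTR c hc => DynNet.NetworkModelSet.T_eq_of_CTR_eq hCTR h.input_excited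
        (hR xi (by simp)) (h.Cb_sub hc)) (fun _ _ h => h) hgen
  · have hgen := h.generically_inputFormula hadm hpar hreg hzero hij hX
    refine ⟨hgen.mono fun θ _ hθ => ⟨DynNet.exists_isGeneralizedInverse _, fun B hB =>
      hθ.eq_of_isGeneralizedInverse rfl hB⟩, fun hR => ?_⟩
    have hR' : M.OnlyR (Xb ∪ {Sum.inl p}) := fun x hx => by
      rcases Finset.mem_union.mp hx with hx | hx
      · exact hR x hx
      · exact ⟨p, Finset.mem_singleton.mp hx⟩
    exact DynNet.NetworkModelSet.determinedByCTR_of_inputFormula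
      (r := fun _ x => if x = Sum.inl p then 1 else 0) hR' h.Cb_sub h.output_measured
      (fun _ _ _ _ _ => rfl) hgen
  · have hgen := h.generically_outputFormula hadm hpar hreg hzero
    refine ⟨hgen.mono fun θ _ hθ => ⟨DynNet.exists_isGeneralizedInverse _, fun B hB => ?_⟩,
      fun hR => ?_⟩
    · rw [← hθ.eq_of_isGeneralizedInverse hB, neg_neg]
    exact DynNet.NetworkModelSet.determinedByCTR_of_outputFormula
      (γ := fun θ => -M.G θ j i) (v := fun _ c => if c = i then 1 else 0)
      (hR.mono Finset.subset_union_left) h.output_excited (hR xj (by simp)) h.Cb_sub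
      (fun _ _ _ _ _ => rfl) (fun _ _ h => neg_injective h) hgen
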